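/- Let $h_n(t) = (2^{n-1}(n-1)!\sqrt{\pi})^{-1/2}(-1)^{n-1}e^{t^2/2}\frac{d^{n-1}}{dt^{n-1}}(e^{-t^2})$, $n=1,2,\dots$, be the Hermite orthonormal basis of $L^2(\mathbb R)$. Let $(e_n)_{n=1}^\infty$ be a sequence of elements of the Schwartz space $\mathcal S(\mathbb R)$ (complex valued) which is a frame for $L^2(\mathbb R)$, i.e. there are $A,B>0$ with $A\|h\|^2\le\sum_{n}|(h,e_n)_{L^2}|^2\le B\|h\|^2$ for all $h\in L^2(\mathbb R)$, and which is polynomially localized with respect to $(h_n)$ with every decay $s\in\mathbb N$, i.e. for each integer $s\ge 1$ there is a constant $C_s$ with $|(e_m,h_n)_{L^2}|\le C_s(1+|m-n|)^{-s}$ for all $m,n\ge 1$. Let $L$ be slowly varying at the origin, i.e. $L$ is a measurable, real-valued and positive function on an interval $(0,A_0]$, $A_0>0$, with $\lim_{\varepsilon\to0^+}L(a\varepsilon)/L(\varepsilon)=1$ for each $a>0$. Let $\alpha,x_0\in\mathbb R$ and let $f\in\mathcal S'(\mathbb R)$ be a tempered distribution; for $\varepsilon>0$ let $f(x_0+\varepsilon\,\cdot)$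 be the tempered distribution $\varphi\mapsto\varepsilon^{-1}\langle f,\varphi((\cdot-x_0)/\varepsilon)\rangle$, where $\langle\cdot,\cdot\rangle$ is the (bilinear) dual pairing. Then there exists $g\in\mathcal S'(\mathbb R)$ such that $$\lim_{\varepsilon\to0^+}\Big\langle\frac{f(x_0+\varepsilon\,\cdot)}{\varepsilon^\alpha L(\varepsilon)},\varphi\Big\rangle=\langle g,\varphi\rangle\quad\text{for each }\varphi\in\mathcal S(\mathbb R)$$ (that is, $f$ has quasiasymptotic behavior of degree $\alpha$ at $x_0$ with respect to $L$) if and only if the following two conditions hold: (i) the limit $\lim_{\varepsilon\to0^+}\big\langle\frac{f(x_0+\varepsilon\,\cdot)}{\varepsilon^\alpha L(\varepsilon)},e_n\big\rangle$ exists in $\mathbb C$ for each $n\ge 1$; (ii) there exist an integer $k\ge 0$ and $\varepsilon_0\in(0,\infty)$ (small enough that $L$ is defined and positive on $(0,\varepsilon_0)$) such that $$\sup_{\varepsilon\in(0,\varepsilon_0)}\ \sup_{n\ge1}\frac{|\langle f(x_0+\varepsilon\,\cdot),e_n\rangle|}{\varepsilon^\alpha L(\varepsilon)\,n^k}<\infty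 .$$ -/

import Mathlib

open Filter Topology MeasureTheory Set
open scoped SchwartzMap InnerProductSpace

noncomputable section

/-! ### Frames and polynomial localization in a Hilbert space -/

/-- A family `u` is a frame for `H`: there are constants `A, B > 0` such that
`A ‖h‖² ≤ ∑ₙ |(h, uₙ)|² ≤ B ‖h‖²` for every `h`. -/
def IsFrame {ι H : Type*} [NormedAddCommGroup H] [InnerProductSpace ℂ H] (u : ι → H) : Prop :=
  ∃ A B : ℝ, 0 < A ∧ 0 < B ∧ ∀ h : H,
    Summable (fun n => ‖⟪u n, h⟫_ℂ‖ ^ 2) ∧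
    A * ‖h‖ ^ 2 ≤ ∑' n, ‖⟪u n, h⟫_ℂ‖ ^ 2 ∧
    ∑' n, ‖⟪u n, h⟫_ℂ‖ ^ 2 ≤ B * ‖h‖ ^ 2

/-- Polynomial localization with decay `γ` of a sequence `u` with respect to a Riesz basis `r`
whose biorthogonal sequence is `r'`. (For an orthonormal basis, `r' = r`.) -/
def IsPolynomiallyLocalized {H : Type*} [NormedAddCommGroup H] [InnerProductSpace ℂ H]
    (γ : ℝ) (u r r' : ℕ → H) : Prop :=
  ∃ C : ℝ, ∀ m n : ℕ,
    max ‖⟪r n, u m⟫_ℂ‖ ‖⟪r' n, u m⟫_ℂ‖ ≤ C * (1 + |(m : ℝ) - (n : ℝ)|) ^ (-γ)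

/-! ### The Hermite functions -/

/-- The normalized Hermite function
`hₙ(t) = (2ⁿ n! √π)^(-1/2) (-1)ⁿ e^(t²/2) dⁿ/dtⁿ (e^(-t²))`, for `n = 0, 1, 2, …`. -/
def hermiteFun (n : ℕ) (t : ℝ) : ℝ :=
  (2 ^ n * (n.factorial : ℝ) * √Real.pi) ^ (-(1 / 2) : ℝ) * (-1) ^ n * Real.exp (t ^ 2 / 2) *
    iteratedDeriv n (fun s : ℝ => Real.exp (-s ^ 2)) t

theorem iteratedDeriv_gaussian_eq (n : ℕ) : ∃ P : Polynomial ℝ,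
    iteratedDeriv n (fun s : ℝ => Real.exp (-s ^ 2)) = fun t => P.eval t * Real.exp (-t ^ 2) := by
  induction n with
  | zero => exact ⟨1, by simp⟩
  | succ n ih =>
    obtain ⟨P, hP⟩ := ih
    refine ⟨Polynomial.derivative P - 2 * Polynomial.X * P, ?_⟩
    rw [iteratedDeriv_succ, hP]
    funext t
    have h1 : HasDerivAt (fun t : ℝ => Real.exp (-t ^ 2)) (Real.exp (-t ^ 2) * (-(2 * t))) t := by
      have := ((hasDerivAt_id t).pow 2).neg.exp
      simpa using this
    have h2 : HasDerivAt (fun t : ℝ => P.eval t * Real.exp (-t ^ 2))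
        ((Polynomial.derivative P).eval t * Real.exp (-t ^ 2) +
          P.eval t * (Real.exp (-t ^ 2) * (-(2 * t)))) t := (P.hasDerivAt t).mul h1
    rw [h2.deriv]
    simp only [Polynomial.eval_sub, Polynomial.eval_mul, Polynomial.eval_X,
      Polynomial.eval_ofNat]
    ring

theorem integrable_polynomial_mul_gaussian (P : Polynomial ℝ) :
    Integrable (fun t : ℝ => P.eval t * Real.exp (-t ^ 2)) := by
  have hmono : ∀ k : ℕ, Integrable (fun t : ℝ => t ^ k * Real.exp (-t ^ 2)) := by
    intro k
    have h := integrable_rpow_mul_exp_neg_mul_sq (b := 1) one_pos (s := (k : ℝ))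
      (by have : (0 : ℝ) ≤ k := k.cast_nonneg
          linarith)
    simpa using h
  have : (fun t : ℝ => P.eval t * Real.exp (-t ^ 2)) =
      fun t => ∑ i ∈ Finset.range (P.natDegree + 1), P.coeff i * (t ^ i * Real.exp (-t ^ 2)) := by
    funext t
    rw [Polynomial.eval_eq_sum_range, Finset.sum_mul]
    simp only [mul_assoc]
  rw [this]
  exact integrable_finsetSum _ fun i _ => (hmono i).const_mul _

theorem memLp_hermiteFun (n : ℕ) : MemLp (fun t : ℝ => (hermiteFun n t : ℂ)) 2 := by
  obtain ⟨P, hP⟩ := iteratedDeriv_gaussian_eq n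
  set c : ℝ := (2 ^ n * (n.factorial : ℝ) * √Real.pi) ^ (-(1 / 2) : ℝ) * (-1) ^ n with hc
  have hform : ∀ t, hermiteFun n t = c * Real.exp (t ^ 2 / 2) * (P.eval t * Real.exp (-t ^ 2)) := by
    intro t
    simp only [hermiteFun, hP, hc]
  have hcont : Continuous fun t : ℝ => (hermiteFun n t : ℂ) := by
    simp only [hform]
    have := P.continuous
    fun_prop
  rw [memLp_two_iff_integrable_sq_norm hcont.aestronglyMeasurable]
  have : (fun t : ℝ => ‖(hermiteFun n t : ℂ)‖ ^ 2) =
      fun t => (Polynomial.C (c ^ 2) * P ^ 2).eval t * Real.exp (-t ^ 2) := by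
    funext t
    have he : Real.exp (t ^ 2 / 2) ^ 2 * Real.exp (-t ^ 2) = 1 := by
      rw [← Real.exp_nat_mul, ← Real.exp_add]
      norm_num
      ring
    rw [Complex.norm_real, Real.norm_eq_abs, sq_abs, hform]
    simp only [Polynomial.eval_mul, Polynomial.eval_C, Polynomial.eval_pow]
    linear_combination (c ^ 2 * P.eval t ^ 2 * Real.exp (-t ^ 2)) * he
  rw [this]
  exact integrable_polynomial_mul_gaussian _

/-- The Hermite functions as elements of the Hilbert space `L²(ℝ)`. -/
def hermiteL2 (n : ℕ) : Lp ℂ 2 (volume : Measure ℝ) := (memLp_hermiteFun n).toLp _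

/-! ### Quasiasymptotic behavior at a point -/

/-- `L` is slowly varying at the origin: it is (Lebesgue) measurable and positive on an interval
`(0, A]`, and `L (a ε) / L ε → 1` as `ε → 0⁺` for each `a > 0`. Values of `L` outside `(0, A]`
play no role. -/
def IsSlowlyVaryingAtOrigin (L : ℝ → ℝ) : Prop :=
  (∃ A : ℝ, 0 < A ∧ AEMeasurable L (volume.restrict (Ioc 0 A)) ∧ ∀ x ∈ Ioc 0 A, 0 < L x) ∧
    ∀ a : ℝ, 0 < a → Tendsto (fun ε => L (a * ε) / L ε) (𝓝[>] 0) (𝓝 1)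

/-- For `ε ≠ 0`, the test function `y ↦ |ε|⁻¹ φ ((y - x₀) / ε)`, depending linearly and
continuously on the test function `φ`; set to `0` for `ε = 0`. -/
def rescaleTest (x₀ ε : ℝ) : 𝓢(ℝ, ℂ) →L[ℂ] 𝓢(ℝ, ℂ) :=
  if h : ε ≠ 0 then
    ((|ε|⁻¹ : ℝ) : ℂ) • (SchwartzMap.compSubConstCLM ℂ x₀ ∘L
      SchwartzMap.compCLMOfContinuousLinearEquiv ℂ
        (ContinuousLinearEquiv.unitsEquivAut ℝ (Units.mk0 ε h)⁻¹))
  else 0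

theorem rescaleTest_apply {x₀ ε : ℝ} (h : ε ≠ 0) (φ : 𝓢(ℝ, ℂ)) (y : ℝ) :
    rescaleTest x₀ ε φ y = ((|ε|⁻¹ : ℝ) : ℂ) * φ ((y - x₀) / ε) := by
  simp [rescaleTest, h, div_eq_mul_inv]

/-- The tempered distribution `f(x₀ + ε ·)`, i.e.
`⟨f(x₀ + ε ·), φ⟩ = |ε|⁻¹ ⟨f, φ((· - x₀) / ε)⟩`. -/
def rescaleDistribution (x₀ ε : ℝ) (f : 𝓢'(ℝ, ℂ)) : 𝓢'(ℝ, ℂ) :=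
  PointwiseConvergenceCLM.precomp ℂ (rescaleTest x₀ ε) f

theorem rescaleDistribution_apply (x₀ ε : ℝ) (f : 𝓢'(ℝ, ℂ)) (φ : 𝓢(ℝ, ℂ)) :
    rescaleDistribution x₀ ε f φ = f (rescaleTest x₀ ε φ) := rfl

/-- The tempered distribution `f(x₀ + ε ·) / (ε^α L(ε))`. -/
def normalizedRescale (α x₀ : ℝ) (L : ℝ → ℝ) (f : 𝓢'(ℝ, ℂ)) (ε : ℝ) : 𝓢'(ℝ, ℂ) :=
  (((ε ^ α * L ε)⁻¹ : ℝ) : ℂ) • rescaleDistribution x₀ ε f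

/-- `f` has quasiasymptotic behavior of degree `α` at the point `x₀` with respect to `L`. -/
def HasQuasiasymptoticBehavior (α x₀ : ℝ) (L : ℝ → ℝ) (f : 𝓢'(ℝ, ℂ)) : Prop :=
  ∃ g : 𝓢'(ℝ, ℂ), ∀ φ : 𝓢(ℝ, ℂ),
    Tendsto (fun ε => normalizedRescale α x₀ L f ε φ) (𝓝[>] 0) (𝓝 (g φ))

end

/-!
A tempered distribution `T` is determined by its values `τ m = T (h m)` on the Hermite functions,
and these grow polynomially. Since the Hermite expansion of a Schwartz function converges in the
Schwartz space, `T (e n) = ∑ m, E n m * τ m` with `E n m = ∫ hₘ eₙ`. The frame inequality says that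
the matrix `E` is bounded below on `ℓ²`, and localization says that it decays faster than any power
away from the diagonal.

The core is `growth_bound_of_localized`: if `T (e n)` grows at most like `B (n + 1)^k`, then `τ m`
grows at most like `M B (m + 1)^(k + 1)`, with `M` independent of `T`. To see this, multiply by the
weight `(1 + x m)^(-(k + 1)) (1 + δ m)^(-K)`. For small `x` and `δ` the weight varies so slowly that
conjugating `E` by it is a small perturbation in the sense of the Schur test, so the lower bound of
`E` survives on the weighted space (`weighted_lower_bound`). The factor with `δ` only serves to make
`τ` square summable, and `δ → 0` at the end, so the constant does not see the unknown growth of `τ`.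
No inverse of the frame operator and no dual frame are needed.

* Sufficiency of the two conditions (`exists_tendsto_of_frame`): the core estimate with exponent
  `k + 1`, applied to differences of the functionals, shows that their values at each `φ` are Cauchy.
  The limit is continuous by Banach–Steinhaus.
* Necessity of the growth condition (`exists_frame_growth_of_tendsto`): otherwise a sequence
  `εⱼ → 0` violates every growth bound. Along it the functionals converge pointwise, so by
  Banach–Steinhaus they are dominated by a single Schwartz seminorm, which grows polynomially along
  `e n` by localization.

Banach–Steinhaus needs the Schwartz space to be barrelled, which follows from its completeness.
Growth of Schwartz seminorms and convergence of Hermite expansions rest on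
`seminorm_le_of_hermiteBound`, which bounds Schwartz seminorms by weighted Hermite coefficients
through the ladder operators `t ± d/dt`, Parseval's identity for the Hermite basis, and the
one-dimensional Sobolev inequality.
-/

open Filter Topology MeasureTheory Set
open scoped SchwartzMap InnerProductSpace

/-! ### The Schwartz space is barrelled -/

section Barrelled

variable {E F : Type*} [NormedAddCommGroup E] [NormedSpace ℝ E] [NormedAddCommGroup F]
  [NormedSpace ℝ F]

/-- A series of Schwartz functions that converges absolutely in every Schwartz seminorm has a
Schwartz function as its pointwise sum. -/
theorem SchwartzMap.exists_eq_tsum [CompleteSpace F] (φ : ℕ → 𝓢(E, F))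
    (h : ∀ k l : ℕ, Summable fun n => SchwartzMap.seminorm ℝ k l (φ n)) :
    ∃ ψ : 𝓢(E, F), (∀ x, ψ x = ∑' n, φ n x) ∧
      ∀ k l : ℕ, SchwartzMap.seminorm ℝ k l ψ ≤ ∑' n, SchwartzMap.seminorm ℝ k l (φ n) := by
  have hsm : ∀ n, ContDiff ℝ (((⊤ : ℕ∞) : ℕ∞) : WithTop ℕ∞) (φ n) := fun n => (φ n).smooth ⊤
  have hb : ∀ (l n : ℕ) (x : E), (l : ℕ∞) ≤ ⊤ →
      ‖iteratedFDeriv ℝ l (φ n) x‖ ≤ SchwartzMap.seminorm ℝ 0 l (φ n) :=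
    fun l n x _ => SchwartzMap.norm_iteratedFDeriv_le_seminorm ℝ (φ n) l x
  have hcd := contDiff_tsum (𝕜 := ℝ) (N := ⊤) hsm (fun l _ => h 0 l) hb
  have hest : ∀ (k l : ℕ) (x : E), ‖x‖ ^ k * ‖iteratedFDeriv ℝ l (fun y => ∑' n, φ n y) x‖ ≤
      ∑' n, SchwartzMap.seminorm ℝ k l (φ n) := by
    intro k l x
    rw [iteratedFDeriv_tsum_apply (𝕜 := ℝ) (N := ⊤) hsm (fun l _ => h 0 l) hb le_top x]
    have hs : Summable fun n => ‖iteratedFDeriv ℝ l (φ n) x‖ :=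
      Summable.of_nonneg_of_le (fun _ => norm_nonneg _) (fun n => hb l n x le_top) (h 0 l)
    calc ‖x‖ ^ k * ‖∑' n, iteratedFDeriv ℝ l (φ n) x‖
        ≤ ‖x‖ ^ k * ∑' n, ‖iteratedFDeriv ℝ l (φ n) x‖ := by
          gcongr
          exact norm_tsum_le_tsum_norm hs
      _ = ∑' n, ‖x‖ ^ k * ‖iteratedFDeriv ℝ l (φ n) x‖ := tsum_mul_left.symm
      _ ≤ ∑' n, SchwartzMap.seminorm ℝ k l (φ n) :=
          (hs.mul_left _).tsum_le_tsum (fun n => SchwartzMap.le_seminorm ℝ k l (φ n) x) (h k l)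
  refine ⟨⟨fun x => ∑' n, φ n x, hcd, fun k l => ⟨_, hest k l⟩⟩, fun x => rfl, fun k l => ?_⟩
  exact SchwartzMap.seminorm_le_bound ℝ k l _
    (tsum_nonneg fun n => apply_nonneg (SchwartzMap.seminorm ℝ k l) (φ n)) (hest k l)

/-- The partial sums of a series of Schwartz functions that converges absolutely in every Schwartz
seminorm converge in the Schwartz space. -/
theorem SchwartzMap.exists_tendsto_sum_range [CompleteSpace F] (φ : ℕ → 𝓢(E, F))
    (h : ∀ k l : ℕ, Summable fun n => SchwartzMap.seminorm ℝ k l (φ n)) :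
    ∃ ψ : 𝓢(E, F), Tendsto (fun N => ∑ n ∈ Finset.range N, φ n) atTop (𝓝 ψ) := by
  obtain ⟨ψ, hψ, -⟩ := SchwartzMap.exists_eq_tsum φ h
  refine ⟨ψ, ?_⟩
  rw [(schwartz_withSeminorms ℝ E F).tendsto_nhds]
  rintro ⟨k, l⟩ ε hε
  have htail := tendsto_sum_nat_add fun n => SchwartzMap.seminorm ℝ k l (φ n)
  filter_upwards [htail.eventually (gt_mem_nhds hε)] with N hN
  obtain ⟨χ, hχ, hχb⟩ := SchwartzMap.exists_eq_tsum (fun n => φ (n + N))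
    fun k l => (summable_nat_add_iff N).2 (h k l)
  have hdiff : (∑ n ∈ Finset.range N, φ n) - ψ = -χ := by
    ext x
    have hs : Summable fun n => φ n x :=
      Summable.of_norm_bounded (h 0 0) fun n => SchwartzMap.norm_le_seminorm ℝ (φ n) x
    have := hs.sum_add_tsum_nat_add N
    rw [sub_apply, neg_apply, hψ, hχ, ← this, sum_apply]
    abel
  rw [hdiff, map_neg_eq_map]
  exact (hχb k l).trans_lt hN

instance SchwartzMap.instIsCountablyGeneratedUniformity :
    (uniformity 𝓢(E, F)).IsCountablyGenerated :=
  IsUniformAddGroup.uniformity_countably_generated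

instance SchwartzMap.instCompleteSpace [CompleteSpace F] : CompleteSpace 𝓢(E, F) := by
  -- It suffices to treat sequences whose increments decay geometrically in the first `n` seminorms.
  let V : ℕ → Set 𝓢(E, F) := fun N =>
    {φ | ∀ p ∈ Finset.range (N + 1) ×ˢ Finset.range (N + 1),
      schwartzSeminormFamily ℝ E F p φ < (1 / 2) ^ N}
  have hV : ∀ N, V N ∈ 𝓝 (0 : 𝓢(E, F)) := by
    intro N
    refine (Filter.eventually_all_finset _).2 fun p _ => ?_
    have hc := (schwartz_withSeminorms ℝ E F).continuous_seminorm p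
    have := hc.tendsto 0
    rw [map_zero] at this
    exact this.eventually (gt_mem_nhds (by positivity))
  refine UniformSpace.complete_of_convergent_controlled_sequences
    (fun N => {q : 𝓢(E, F) × 𝓢(E, F) | q.2 - q.1 ∈ V N}) (fun N => ?_) fun u hu => ?_
  · rw [uniformity_eq_comap_nhds_zero]
    exact preimage_mem_comap (hV N)
  · obtain ⟨ψ, hψ⟩ := SchwartzMap.exists_tendsto_sum_range (fun n => u (n + 1) - u n) fun k l => by
      rw [← summable_nat_add_iff (max k l)]
      refine Summable.of_nonneg_of_le (fun n => apply_nonneg _ _) (fun n => ?_)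
        (summable_geometric_of_lt_one (r := (1 / 2 : ℝ)) (by norm_num) (by norm_num))
      have h1 := hu (n + max k l) (n + max k l) (n + max k l + 1) le_rfl (Nat.le_succ _) (k, l)
        (by simp only [Finset.mem_product, Finset.mem_range]; omega)
      refine h1.le.trans ?_
      exact pow_le_pow_of_le_one (by norm_num) (by norm_num) (Nat.le_add_right _ _)
    refine ⟨ψ + u 0, ?_⟩
    simp only [Finset.sum_range_sub] at hψ
    simpa using hψ.add_const (u 0)

end Barrelled

/-- The Banach–Steinhaus theorem on the Schwartz space: a pointwise bounded family of continuous
functionals is dominated by one finite maximum of Schwartz seminorms. -/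
theorem SchwartzMap.exists_bound_of_pointwise_bounded {ι : Type*} (T : ι → 𝓢(ℝ, ℂ) →L[ℂ] ℂ)
    (hT : ∀ φ, ∃ M, ∀ i, ‖T i φ‖ ≤ M) :
    ∃ (s : Finset (ℕ × ℕ)) (C : ℝ), ∀ i φ,
      ‖T i φ‖ ≤ C * (s.sup (schwartzSeminormFamily ℂ ℝ ℂ)) φ := by
  let p : ι → Seminorm ℂ 𝓢(ℝ, ℂ) := fun i => (normSeminorm ℂ ℂ).comp (T i).toLinearMap
  have hbdd : BddAbove (range p) := Seminorm.bddAbove_range_iff.2 fun φ => by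
    obtain ⟨M, hM⟩ := hT φ
    exact ⟨M, by rintro _ ⟨i, rfl⟩; exact hM i⟩
  have hcont : Continuous (⨆ i, p i : Seminorm ℂ 𝓢(ℝ, ℂ)) := by
    rw [Seminorm.coe_iSup_eq hbdd]
    exact Seminorm.continuous_iSup p (fun i => (T i).continuous.norm) hbdd
  obtain ⟨s, C, -, hC⟩ :=
    Seminorm.bound_of_continuous (schwartz_withSeminorms ℂ ℝ ℂ) _ hcont
  refine ⟨s, C, fun i φ => ?_⟩
  have h1 := hC φ
  rw [Seminorm.iSup_apply hbdd] at h1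
  exact (le_ciSup (Seminorm.bddAbove_range_iff.1 hbdd φ) i).trans h1

/-! ### Hermite functions and ladder operators on the Schwartz space -/

theorem exists_bound_polynomial_mul_gaussian (P : Polynomial ℝ) :
    ∃ C : ℝ, ∀ x : ℝ, |P.eval x| * Real.exp (-(x ^ 2 / 2)) ≤ C := by
  induction P using Polynomial.induction_on' with
  | add P Q hP hQ =>
    obtain ⟨C, hC⟩ := hP
    obtain ⟨D, hD⟩ := hQ
    refine ⟨C + D, fun x => ?_⟩
    rw [Polynomial.eval_add]
    calc |P.eval x + Q.eval x| * Real.exp (-(x ^ 2 / 2))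
        ≤ (|P.eval x| + |Q.eval x|) * Real.exp (-(x ^ 2 / 2)) := by
          gcongr
          exact abs_add_le _ _
      _ ≤ C + D := by
          rw [add_mul]
          exact add_le_add (hC x) (hD x)
  | monomial n a =>
    refine ⟨|a| * (1 + n.factorial * 2 ^ n), fun x => ?_⟩
    rw [Polynomial.eval_monomial, abs_mul, mul_assoc]
    gcongr
    have h1 := Real.pow_div_factorial_le_exp (x ^ 2 / 2) (by positivity) n
    have h2 : |x ^ n| ≤ 1 + (x ^ 2) ^ n := by
      rw [← pow_mul, mul_comm 2 n, pow_mul, ← sq_abs (x ^ n)]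
      nlinarith [sq_nonneg (|x ^ n| - 1 / 2)]
    have h3 : (x ^ 2) ^ n ≤ n.factorial * 2 ^ n * Real.exp (x ^ 2 / 2) := by
      rw [div_pow, div_div, div_le_iff₀ (by positivity)] at h1
      linarith
    have h4 : (1 : ℝ) ≤ Real.exp (x ^ 2 / 2) := Real.one_le_exp (by positivity)
    rw [Real.exp_neg, ← div_eq_mul_inv, div_le_iff₀ (Real.exp_pos _)]
    linarith

/-- The Gaussian `t ↦ e^(-t²/2)` as a Schwartz function. -/
noncomputable def gaussianSchwartz : 𝓢(ℝ, ℂ) where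
  toFun t := (Real.exp (-(t ^ 2 / 2)) : ℂ)
  smooth' := by
    have : ContDiff ℝ ((⊤ : ℕ∞) : WithTop ℕ∞) fun t : ℝ => Real.exp (-(t ^ 2 / 2)) := by fun_prop
    exact Complex.ofRealCLM.contDiff.comp this
  decay' k n := by
    obtain ⟨C, hC⟩ := exists_bound_polynomial_mul_gaussian
      (Polynomial.X ^ k * (Polynomial.hermite n).map (Int.castRingHom ℝ))
    refine ⟨C, fun x => ?_⟩
    have hsm : ContDiff ℝ n fun t : ℝ => Real.exp (-(t ^ 2 / 2)) := by fun_prop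
    have h1 : ‖iteratedFDeriv ℝ n (fun t : ℝ => ((Real.exp (-(t ^ 2 / 2)) : ℝ) : ℂ)) x‖ =
        ‖iteratedFDeriv ℝ n (fun t : ℝ => Real.exp (-(t ^ 2 / 2))) x‖ :=
      Complex.ofRealLI.norm_iteratedFDeriv_comp_left hsm.contDiffAt le_rfl
    rw [h1, norm_iteratedFDeriv_eq_norm_iteratedDeriv, iteratedDeriv_eq_iterate,
      Polynomial.deriv_gaussian_eq_hermite_mul_gaussian]
    refine le_trans (le_of_eq ?_) (hC x)
    rw [Polynomial.eval_mul, Polynomial.eval_pow, Polynomial.eval_X, Polynomial.eval_map,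
      Polynomial.aeval_def, abs_mul, abs_pow, norm_mul, norm_mul, norm_pow]
    simp [mul_assoc, Polynomial.eval₂_eq_eval_map]

theorem gaussianSchwartz_apply (t : ℝ) :
    gaussianSchwartz t = (Real.exp (-(t ^ 2 / 2)) : ℝ) := rfl

/-- Multiplication by the coordinate on the Schwartz space. -/
noncomputable def mulCoord : 𝓢(ℝ, ℂ) →L[ℂ] 𝓢(ℝ, ℂ) :=
  SchwartzMap.smulLeftCLM ℂ (fun t : ℝ => (t : ℂ))

theorem mulCoord_apply (φ : 𝓢(ℝ, ℂ)) (t : ℝ) : mulCoord φ t = t * φ t := by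
  rw [mulCoord, SchwartzMap.smulLeftCLM_apply_apply (by fun_prop), smul_eq_mul]

/-- The (unnormalized) creation operator `t - d/dt`. -/
noncomputable def creationOp : 𝓢(ℝ, ℂ) →L[ℂ] 𝓢(ℝ, ℂ) := mulCoord - SchwartzMap.derivCLM ℂ ℂ

/-- The (unnormalized) annihilation operator `t + d/dt`. -/
noncomputable def annihilationOp : 𝓢(ℝ, ℂ) →L[ℂ] 𝓢(ℝ, ℂ) := mulCoord + SchwartzMap.derivCLM ℂ ℂ

theorem creationOp_apply (φ : 𝓢(ℝ, ℂ)) (t : ℝ) : creationOp φ t = t * φ t - deriv φ t := by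
  simp [creationOp, mulCoord_apply]

theorem annihilationOp_apply (φ : 𝓢(ℝ, ℂ)) (t : ℝ) :
    annihilationOp φ t = t * φ t + deriv φ t := by
  simp [annihilationOp, mulCoord_apply]

theorem mulCoord_eq (φ : 𝓢(ℝ, ℂ)) :
    mulCoord φ = (2⁻¹ : ℂ) • (annihilationOp φ + creationOp φ) := by
  ext t
  simp [mulCoord_apply, creationOp_apply, annihilationOp_apply]
  ring

theorem derivCLM_eq (φ : 𝓢(ℝ, ℂ)) :
    SchwartzMap.derivCLM ℂ ℂ φ = (2⁻¹ : ℂ) • (annihilationOp φ - creationOp φ) := by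
  ext t
  simp [creationOp_apply, annihilationOp_apply]
  ring

/-- The commutation relation `[t + d/dt, t - d/dt] = 2`. -/
theorem annihilationOp_creationOp (φ : 𝓢(ℝ, ℂ)) :
    annihilationOp (creationOp φ) = creationOp (annihilationOp φ) + (2 : ℂ) • φ := by
  have h : ∀ t, SchwartzMap.derivCLM ℂ ℂ (mulCoord φ) t = φ t + t * deriv φ t := fun t => by
    rw [SchwartzMap.derivCLM_apply]
    have h1 : HasDerivAt (fun s : ℝ => (s : ℂ) * φ s) (1 * φ t + t * deriv φ t) t :=
      (Complex.ofRealCLM.hasDerivAt (x := t)).mul (φ.hasDerivAt t)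
    rw [show ((mulCoord φ : 𝓢(ℝ, ℂ)) : ℝ → ℂ) = fun s : ℝ => (s : ℂ) * φ s from
      funext (mulCoord_apply φ), h1.deriv, one_mul]
  ext t
  have := h t
  simp only [creationOp, annihilationOp, add_apply, sub_apply, map_add, map_sub,
    mulCoord_apply, smul_apply,
    smul_eq_mul, SchwartzMap.derivCLM_apply] at this ⊢
  rw [this]
  ring

/-- The Hermite functions as Schwartz functions, generated from the Gaussian by the creation
operator. -/
noncomputable def hermiteSchwartz : ℕ → 𝓢(ℝ, ℂ)
  | 0 => (((√Real.pi) ^ (-(1 / 2) : ℝ) : ℝ) : ℂ) • gaussianSchwartz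
  | n + 1 => (((√(2 * (n + 1)))⁻¹ : ℝ) : ℂ) • creationOp (hermiteSchwartz n)

theorem creationOp_hermiteSchwartz (n : ℕ) :
    creationOp (hermiteSchwartz n) = ((√(2 * (n + 1)) : ℝ) : ℂ) • hermiteSchwartz (n + 1) := by
  have h : √(2 * ((n : ℝ) + 1)) ≠ 0 := by positivity
  rw [hermiteSchwartz, smul_smul, ← Complex.ofReal_mul, mul_inv_cancel₀ h, Complex.ofReal_one,
    one_smul]

theorem annihilationOp_hermiteSchwartz_zero : annihilationOp (hermiteSchwartz 0) = 0 := by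
  have h : annihilationOp gaussianSchwartz = 0 := by
    ext t
    have h1 : HasDerivAt (fun s : ℝ => Real.exp (-(s ^ 2 / 2)))
        (Real.exp (-(t ^ 2 / 2)) * (-t)) t := by
      have := (((hasDerivAt_id t).pow 2).div_const 2).neg.exp
      simpa using this
    have h2 := h1.ofReal_comp
    rw [annihilationOp_apply, show (gaussianSchwartz : ℝ → ℂ) =
      fun s : ℝ => ((Real.exp (-(s ^ 2 / 2)) : ℝ) : ℂ) from rfl, h2.deriv]
    push_cast
    simp
    ring
  rw [hermiteSchwartz, map_smul, h, smul_zero]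

theorem annihilationOp_hermiteSchwartz_succ (n : ℕ) :
    annihilationOp (hermiteSchwartz (n + 1)) =
      ((√(2 * (n + 1)) : ℝ) : ℂ) • hermiteSchwartz n := by
  have key : ∀ n : ℕ, creationOp (annihilationOp (hermiteSchwartz n)) =
      ((2 * n : ℝ) : ℂ) • hermiteSchwartz n → annihilationOp (hermiteSchwartz (n + 1)) =
      ((√(2 * (n + 1)) : ℝ) : ℂ) • hermiteSchwartz n := by
    intro n hn
    have h : √(2 * ((n : ℝ) + 1)) ≠ 0 := by positivity
    rw [hermiteSchwartz, map_smul, annihilationOp_creationOp, hn, ← add_smul, smul_smul]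
    congr 1
    rw [show (2 : ℂ) = ((2 : ℝ) : ℂ) by simp, ← Complex.ofReal_add, ← Complex.ofReal_mul]
    congr 1
    field_simp
    rw [Real.sq_sqrt (by positivity)]
  induction n with
  | zero => exact key 0 (by rw [annihilationOp_hermiteSchwartz_zero]; simp)
  | succ n ih =>
    refine key _ ?_
    rw [ih, map_smul, creationOp_hermiteSchwartz, smul_smul, ← Complex.ofReal_mul,
      Real.mul_self_sqrt (by positivity)]
    push_cast
    rfl

theorem hermiteSchwartz_apply (n : ℕ) (t : ℝ) : hermiteSchwartz n t = hermiteFun n t := by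
  induction n generalizing t with
  | zero =>
    rw [hermiteSchwartz, smul_apply, gaussianSchwartz_apply, smul_eq_mul,
      ← Complex.ofReal_mul, hermiteFun]
    congr 1
    simp only [pow_zero, Nat.factorial_zero, Nat.cast_one, one_mul, mul_one, iteratedDeriv_zero]
    rw [mul_assoc, ← Real.exp_add]
    ring_nf
  | succ n ih =>
    obtain ⟨P, hP⟩ := iteratedDeriv_gaussian_eq n
    have hG : Differentiable ℝ (iteratedDeriv n fun s : ℝ => Real.exp (-s ^ 2)) := by
      rw [hP]
      have := P.differentiable
      fun_prop
    have hd : HasDerivAt (hermiteFun n) (t * hermiteFun n t -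
        √(2 * (n + 1)) * hermiteFun (n + 1) t) t := by
      have h1 : HasDerivAt (fun s : ℝ => Real.exp (s ^ 2 / 2)) (Real.exp (t ^ 2 / 2) * t) t := by
        have := (((hasDerivAt_id t).pow 2).div_const 2).exp
        simpa using this
      have h2 := (h1.const_mul ((2 ^ n * (n.factorial : ℝ) * √Real.pi) ^ (-(1 / 2) : ℝ) *
        (-1) ^ n)).mul (hG t).hasDerivAt
      rw [← iteratedDeriv_succ] at h2
      refine h2.congr_deriv ?_
      have hc : √(2 * ((n : ℝ) + 1)) *
          (2 ^ (n + 1) * ((n + 1).factorial : ℝ) * √Real.pi) ^ (-(1 / 2) : ℝ) =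
          (2 ^ n * (n.factorial : ℝ) * √Real.pi) ^ (-(1 / 2) : ℝ) := by
        rw [show (2 ^ (n + 1) * ((n + 1).factorial : ℝ) * √Real.pi) =
          (2 * (n + 1)) * (2 ^ n * (n.factorial : ℝ) * √Real.pi) by
            rw [Nat.factorial_succ]; push_cast; ring,
          Real.mul_rpow (by positivity) (by positivity), Real.sqrt_eq_rpow, ← mul_assoc,
          ← Real.rpow_add (by positivity)]
        norm_num
      simp only [hermiteFun]
      rw [← hc]
      ring
    have h : √(2 * ((n : ℝ) + 1)) ≠ 0 := by positivity
    rw [hermiteSchwartz, smul_apply, creationOp_apply, show (hermiteSchwartz n : ℝ → ℂ) =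
      fun s => (hermiteFun n s : ℂ) from funext ih, hd.ofReal_comp.deriv, smul_eq_mul,
      ← Complex.ofReal_mul, ← Complex.ofReal_sub, ← Complex.ofReal_mul]
    congr 1
    field_simp
    ring

/-- The Hermite coefficient `φ ↦ ∫ hₙ φ` of a Schwartz function. -/
noncomputable def hermiteCoeff (n : ℕ) : 𝓢(ℝ, ℂ) →L[ℂ] ℂ :=
  SchwartzMap.integralCLM ℂ (volume : Measure ℝ) ∘L
    SchwartzMap.smulLeftCLM ℂ (hermiteSchwartz n)

theorem hermiteCoeff_apply (n : ℕ) (φ : 𝓢(ℝ, ℂ)) :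
    hermiteCoeff n φ = ∫ t, hermiteSchwartz n t * φ t := by
  rw [hermiteCoeff, ContinuousLinearMap.comp_apply, SchwartzMap.integralCLM_apply]
  simp only [SchwartzMap.smulLeftCLM_apply_apply (hermiteSchwartz n).hasTemperateGrowth,
    smul_eq_mul]

theorem SchwartzMap.integrable_mul (φ ψ : 𝓢(ℝ, ℂ)) : Integrable fun t => φ t * ψ t := by
  have := (SchwartzMap.smulLeftCLM ℂ φ ψ).integrable (μ := volume)
  refine this.congr (Eventually.of_forall fun t => ?_)
  simp only [SchwartzMap.smulLeftCLM_apply_apply φ.hasTemperateGrowth, smul_eq_mul]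

theorem integral_creationOp_mul (φ ψ : 𝓢(ℝ, ℂ)) :
    ∫ t, creationOp φ t * ψ t = ∫ t, φ t * annihilationOp ψ t := by
  have h1 := φ.integral_mul_deriv_eq_neg_deriv_mul ψ
  have i1 := SchwartzMap.integrable_mul (mulCoord φ) ψ
  have i2 := SchwartzMap.integrable_mul (SchwartzMap.derivCLM ℂ ℂ φ) ψ
  have i3 := SchwartzMap.integrable_mul φ (mulCoord ψ)
  have i4 := SchwartzMap.integrable_mul φ (SchwartzMap.derivCLM ℂ ℂ ψ)
  simp only [SchwartzMap.derivCLM_apply, mulCoord_apply] at i1 i2 i3 i4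
  simp only [creationOp_apply, annihilationOp_apply, sub_mul, mul_add]
  rw [integral_sub i1 i2, integral_add i3 i4, h1, sub_eq_add_neg]
  congr 2
  funext t
  ring

theorem hermiteCoeff_creationOp_zero (φ : 𝓢(ℝ, ℂ)) : hermiteCoeff 0 (creationOp φ) = 0 := by
  have h := integral_creationOp_mul φ (hermiteSchwartz 0)
  rw [annihilationOp_hermiteSchwartz_zero] at h
  simpa [hermiteCoeff_apply, mul_comm] using h

theorem hermiteCoeff_creationOp_succ (n : ℕ) (φ : 𝓢(ℝ, ℂ)) :
    hermiteCoeff (n + 1) (creationOp φ) = √(2 * (n + 1)) * hermiteCoeff n φ := by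
  have h := integral_creationOp_mul φ (hermiteSchwartz (n + 1))
  rw [annihilationOp_hermiteSchwartz_succ] at h
  rw [hermiteCoeff_apply, hermiteCoeff_apply, ← integral_const_mul]
  simp only [smul_apply, smul_eq_mul] at h
  simpa only [mul_comm, mul_left_comm] using h

theorem hermiteCoeff_annihilationOp (n : ℕ) (φ : 𝓢(ℝ, ℂ)) :
    hermiteCoeff n (annihilationOp φ) = √(2 * (n + 1)) * hermiteCoeff (n + 1) φ := by
  have h := integral_creationOp_mul (hermiteSchwartz n) φ
  rw [creationOp_hermiteSchwartz] at h
  rw [hermiteCoeff_apply, hermiteCoeff_apply, ← integral_const_mul, ← h]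
  simp only [smul_apply, smul_eq_mul, mul_assoc]

theorem hermiteCoeff_hermiteSchwartz (n m : ℕ) :
    hermiteCoeff n (hermiteSchwartz m) = if n = m then 1 else 0 := by
  induction m generalizing n with
  | zero =>
    cases n with
    | zero =>
      have hpt : ∀ t : ℝ, hermiteSchwartz 0 t * hermiteSchwartz 0 t =
          (((√Real.pi)⁻¹ * Real.exp (-1 * t ^ 2) : ℝ) : ℂ) := fun t => by
        rw [hermiteSchwartz, smul_apply, gaussianSchwartz_apply, smul_eq_mul,
          ← Complex.ofReal_mul, ← Complex.ofReal_mul]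
        congr 1
        rw [mul_mul_mul_comm, ← Real.exp_add, ← Real.rpow_add (by positivity)]
        congr 1
        · norm_num [Real.rpow_neg_one]
        · ring_nf
      rw [hermiteCoeff_apply, if_pos rfl]
      simp_rw [hpt]
      rw [integral_complex_ofReal, integral_const_mul, integral_gaussian, div_one,
        inv_mul_cancel₀ (by positivity), Complex.ofReal_one]
    | succ n =>
      have h := hermiteCoeff_annihilationOp n (hermiteSchwartz 0)
      rw [annihilationOp_hermiteSchwartz_zero, map_zero] at h
      have h2 : ((√(2 * ((n : ℝ) + 1)) : ℝ) : ℂ) ≠ 0 :=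
        Complex.ofReal_ne_zero.2 (by positivity)
      rw [if_neg (Nat.succ_ne_zero n)]
      exact (mul_eq_zero.1 h.symm).resolve_left h2
  | succ m ih =>
    rw [hermiteSchwartz, map_smul]
    cases n with
    | zero => simp [hermiteCoeff_creationOp_zero]
    | succ n =>
      rw [hermiteCoeff_creationOp_succ, ih]
      by_cases h : n = m
      · subst h
        have h2 : √(2 * ((n : ℝ) + 1)) ≠ 0 := by positivity
        rw [if_pos rfl, if_pos rfl, mul_one, smul_eq_mul, ← Complex.ofReal_mul,
          inv_mul_cancel₀ h2, Complex.ofReal_one]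
      · simp [h]

/-! ### The Hermite functions form a Hilbert basis -/

theorem toLp_hermiteSchwartz (n : ℕ) :
    (hermiteSchwartz n).toLp 2 (volume : Measure ℝ) = hermiteL2 n := by
  refine (MemLp.toLp_eq_toLp_iff _ _).2 (Eventually.of_forall fun t => ?_)
  exact hermiteSchwartz_apply n t

theorem inner_hermiteL2_toLp (n : ℕ) (φ : 𝓢(ℝ, ℂ)) :
    ⟪hermiteL2 n, φ.toLp 2 (volume : Measure ℝ)⟫_ℂ = hermiteCoeff n φ := by
  rw [← toLp_hermiteSchwartz, SchwartzMap.inner_toL2_toL2_eq (hermiteSchwartz n) φ volume,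
    hermiteCoeff_apply]
  congr 1
  funext t
  rw [RCLike.inner_apply, hermiteSchwartz_apply, Complex.conj_ofReal, mul_comm]

theorem orthonormal_hermiteL2 : Orthonormal ℂ hermiteL2 := by
  rw [orthonormal_iff_ite]
  intro i j
  rw [← toLp_hermiteSchwartz j, inner_hermiteL2_toLp, hermiteCoeff_hermiteSchwartz]

/-- An integrable function with sufficient decay all of whose moments vanish has vanishing Fourier
integral: expand the exponential. -/
theorem integral_exp_mul_eq_zero_of_moments {F : ℝ → ℂ} {a : ℂ}
    (hF : AEStronglyMeasurable F) (hexp : Integrable fun t : ℝ => Real.exp (‖a‖ * |t|) * ‖F t‖)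
    (hmom : ∀ k : ℕ, ∫ t : ℝ, (t : ℂ) ^ k * F t = 0) :
    ∫ t : ℝ, Complex.exp (a * t) * F t = 0 := by
  have hreal : ∀ x : ℝ, HasSum (fun k : ℕ => x ^ k / k.factorial) (Real.exp x) := fun x => by
    rw [Real.exp_eq_exp_ℝ]
    exact NormedSpace.expSeries_div_hasSum_exp x
  have hcomplex : ∀ z : ℂ, HasSum (fun k : ℕ => z ^ k / k.factorial) (Complex.exp z) := fun z => by
    rw [Complex.exp_eq_exp_ℂ]
    exact NormedSpace.expSeries_div_hasSum_exp z
  have h := hasSum_integral_of_dominated_convergence (μ := (volume : Measure ℝ))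
    (F := fun (k : ℕ) (t : ℝ) => (a * t) ^ k / k.factorial * F t)
    (f := fun t : ℝ => Complex.exp (a * t) * F t)
    (fun k t => (‖a‖ * |t|) ^ k / k.factorial * ‖F t‖)
    (fun k => (Continuous.aestronglyMeasurable (by fun_prop)).mul hF)
    (fun k => Eventually.of_forall fun t => by simp [mul_pow])
    (Eventually.of_forall fun t => ((hreal _).mul_right _).summable)
    (hexp.congr (Eventually.of_forall fun t => (((hreal _).mul_right _).tsum_eq).symm))
    (Eventually.of_forall fun t => (hcomplex _).mul_right _)
  refine h.unique ?_
  have hzero : ∀ k : ℕ, ∫ t : ℝ, (a * t) ^ k / k.factorial * F t = 0 := fun k => by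
    rw [show (fun t : ℝ => (a * t) ^ k / k.factorial * F t) =
      fun t : ℝ => (a ^ k / k.factorial) * ((t : ℂ) ^ k * F t) by funext t; ring,
      integral_const_mul, hmom, mul_zero]
  simp only [hzero]
  exact hasSum_zero

/-- An integrable function whose Fourier integral vanishes is zero almost everywhere. -/
theorem ae_eq_zero_of_fourier_eq_zero {F : ℝ → ℂ} (hF : Integrable F)
    (h : ∀ ξ : ℝ, ∫ t : ℝ, Complex.exp ((-2 * Real.pi * ξ * Complex.I) * t) * F t = 0) :
    ∀ᵐ t : ℝ, F t = 0 := by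
  refine ae_eq_zero_of_integral_contDiff_smul_eq_zero hF.locallyIntegrable fun χ hχ hχs => ?_
  have hχs' : HasCompactSupport fun t => (χ t : ℂ) := hχs.comp_left Complex.ofReal_zero
  have hχ' : ContDiff ℝ ((⊤ : ℕ∞) : WithTop ℕ∞) fun t => (χ t : ℂ) :=
    Complex.ofRealCLM.contDiff.comp hχ
  set φ : 𝓢(ℝ, ℂ) := hχs'.toSchwartzMap hχ' with hφ
  -- Write the test function as a Fourier transform and move the transform onto `F`.
  set ψ : 𝓢(ℝ, ℂ) := FourierTransformInv.fourierInv φ with hψ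
  have hflip := VectorFourier.integral_fourierIntegral_smul_eq_flip (e := Real.fourierChar)
    (L := innerₗ ℝ) (μ := (volume : Measure ℝ)) (ν := (volume : Measure ℝ))
    Real.continuous_fourierChar (by fun_prop) ψ.integrable hF
  have hz : ∀ ξ : ℝ,
      VectorFourier.fourierIntegral Real.fourierChar volume (innerₗ ℝ).flip F ξ = 0 := by
    intro ξ
    rw [← h ξ, VectorFourier.fourierIntegral]
    congr 1
    funext t
    rw [Circle.smul_def, Real.fourierChar_apply, smul_eq_mul]
    congr 2
    simp
    ring
  simp only [hz, smul_zero, integral_zero] at hflip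
  rw [← hflip]
  congr 1
  funext t
  have h1 : FourierTransform.fourier (ψ : ℝ → ℂ) t = χ t := by
    rw [← SchwartzMap.fourier_coe, hψ, FourierTransform.fourier_fourierInv_eq]
    rfl
  have h2 : VectorFourier.fourierIntegral Real.fourierChar volume (innerₗ ℝ) (ψ : ℝ → ℂ) t = χ t :=
    h1
  rw [h2]
  simp

theorem mulCoord_hermiteSchwartz_mem_span (n : ℕ) :
    mulCoord (hermiteSchwartz n) ∈ Submodule.span ℂ (range hermiteSchwartz) := by
  have hmem : ∀ m, hermiteSchwartz m ∈ Submodule.span ℂ (range hermiteSchwartz) :=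
    fun m => Submodule.subset_span ⟨m, rfl⟩
  rw [mulCoord_eq, creationOp_hermiteSchwartz]
  refine Submodule.smul_mem _ _ (Submodule.add_mem _ ?_ (Submodule.smul_mem _ _ (hmem _)))
  cases n with
  | zero => rw [annihilationOp_hermiteSchwartz_zero]; exact Submodule.zero_mem _
  | succ n =>
    rw [annihilationOp_hermiteSchwartz_succ]
    exact Submodule.smul_mem _ _ (hmem _)

theorem mulCoord_iterate_hermiteSchwartz_mem_span (k : ℕ) :
    mulCoord^[k] (hermiteSchwartz 0) ∈ Submodule.span ℂ (range hermiteSchwartz) := by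
  induction k with
  | zero => exact Submodule.subset_span ⟨0, rfl⟩
  | succ k ih =>
    rw [Function.iterate_succ_apply']
    have : Submodule.span ℂ (range hermiteSchwartz) ≤
        (Submodule.span ℂ (range hermiteSchwartz)).comap mulCoord.toLinearMap := by
      rw [Submodule.span_le]
      rintro _ ⟨n, rfl⟩
      exact mulCoord_hermiteSchwartz_mem_span n
    exact this ih

theorem mulCoord_iterate_apply (k : ℕ) (φ : 𝓢(ℝ, ℂ)) (t : ℝ) :
    (mulCoord^[k] φ) t = (t : ℂ) ^ k * φ t := by
  induction k with
  | zero => simp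
  | succ k ih => rw [Function.iterate_succ_apply', mulCoord_apply, ih, pow_succ']; ring

theorem memLp_exp_mul_gaussian (b : ℝ) :
    MemLp (fun t : ℝ => Real.exp (b * |t|) * Real.exp (-(t ^ 2 / 2))) 2 := by
  rw [memLp_two_iff_integrable_sq_norm (Continuous.aestronglyMeasurable (by fun_prop))]
  refine Integrable.mono' ((integrable_exp_neg_mul_sq (b := 1 / 2) (by norm_num)).const_mul
    (Real.exp (2 * b ^ 2))) (Continuous.aestronglyMeasurable (by fun_prop))
    (Eventually.of_forall fun t => ?_)
  rw [← Real.exp_add, ← Real.exp_add, Real.norm_eq_abs, Real.norm_eq_abs, Real.abs_exp, abs_pow,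
    Real.abs_exp, ← Real.exp_nat_mul]
  refine Real.exp_le_exp.2 ?_
  push_cast
  nlinarith [sq_nonneg (2 * b - |t|), sq_abs t]

theorem hermiteL2_orthogonal_eq_bot : (Submodule.span ℂ (range hermiteL2))ᗮ = ⊥ := by
  rw [Submodule.eq_bot_iff]
  intro g hg
  let I : 𝓢(ℝ, ℂ) →L[ℂ] ℂ := innerSL ℂ g ∘L SchwartzMap.toLpCLM ℂ ℂ 2 (volume : Measure ℝ)
  have hI : ∀ φ, I φ = ∫ t, φ t * (starRingEnd ℂ) (g t) := fun φ => by
    change ⟪g, φ.toLp 2 (volume : Measure ℝ)⟫_ℂ = _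
    rw [L2.inner_def]
    refine integral_congr_ae ?_
    filter_upwards [φ.coeFn_toLp 2 (volume : Measure ℝ)] with t ht
    rw [ht, RCLike.inner_apply]
  have hI0 : ∀ φ ∈ Submodule.span ℂ (range hermiteSchwartz), I φ = 0 := by
    have : Submodule.span ℂ (range hermiteSchwartz) ≤ LinearMap.ker I.toLinearMap := by
      rw [Submodule.span_le]
      rintro _ ⟨n, rfl⟩
      change ⟪g, (hermiteSchwartz n).toLp 2 (volume : Measure ℝ)⟫_ℂ = 0
      rw [toLp_hermiteSchwartz]
      exact (Submodule.mem_orthogonal' _ g).1 hg _ (Submodule.subset_span (mem_range_self n))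
    exact fun φ hφ => this hφ
  set F : ℝ → ℂ := fun t => (Real.exp (-(t ^ 2 / 2)) : ℂ) * (starRingEnd ℂ) (g t) with hFdef
  have hgm : AEStronglyMeasurable (fun t => (starRingEnd ℂ) (g t)) :=
    Complex.continuous_conj.comp_aestronglyMeasurable (Lp.aestronglyMeasurable g)
  have hFm : AEStronglyMeasurable F := (Continuous.aestronglyMeasurable (by fun_prop)).mul hgm
  have hFexp : ∀ b : ℝ, Integrable fun t => Real.exp (b * |t|) * ‖F t‖ := fun b => by
    have h := (memLp_exp_mul_gaussian b).integrable_mul (Lp.memLp g).norm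
    refine h.congr (Eventually.of_forall fun t => ?_)
    simp only [Pi.mul_apply, hFdef, norm_mul, RCLike.norm_conj, Complex.norm_real,
      Real.norm_eq_abs, Real.abs_exp, mul_assoc]
  have hFint : Integrable F := by
    have := hFexp 0
    simp only [zero_mul, Real.exp_zero, one_mul] at this
    exact (integrable_norm_iff hFm).1 this
  have hmom : ∀ k : ℕ, ∫ t : ℝ, (t : ℂ) ^ k * F t = 0 := by
    intro k
    have h := hI0 _ (mulCoord_iterate_hermiteSchwartz_mem_span k)
    rw [hI] at h
    have hc : ((((√Real.pi) ^ (-(1 / 2) : ℝ) : ℝ) : ℂ)) ≠ 0 :=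
      Complex.ofReal_ne_zero.2 (by positivity)
    refine (mul_eq_zero.1 (Eq.trans ?_ h)).resolve_left hc
    rw [← integral_const_mul]
    congr 1
    funext t
    rw [mulCoord_iterate_apply, hermiteSchwartz, smul_apply, gaussianSchwartz_apply,
      smul_eq_mul]
    ring
  have hF0 := ae_eq_zero_of_fourier_eq_zero hFint fun ξ =>
    integral_exp_mul_eq_zero_of_moments hFm (hFexp _) hmom
  refine (Lp.eq_zero_iff_ae_eq_zero).2 ?_
  filter_upwards [hF0] with t ht
  have : ((Real.exp (-(t ^ 2 / 2)) : ℝ) : ℂ) ≠ 0 := Complex.ofReal_ne_zero.2 (Real.exp_pos _).ne'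
  exact (map_eq_zero _).1 ((mul_eq_zero.1 ht).resolve_left this)

/-- The Hermite functions as a Hilbert basis of `L²(ℝ)`. -/
noncomputable def hermiteBasis : HilbertBasis ℕ ℂ (Lp ℂ 2 (volume : Measure ℝ)) :=
  HilbertBasis.mkOfOrthogonalEqBot orthonormal_hermiteL2 hermiteL2_orthogonal_eq_bot

theorem hermiteBasis_apply (n : ℕ) : hermiteBasis n = hermiteL2 n := by
  rw [hermiteBasis, HilbertBasis.coe_mkOfOrthogonalEqBot]

/-! ### Schwartz seminorms and weighted Hermite coefficients -/

/-- The Hermite coefficients of `φ` satisfy `(m + 1)^q |∫ hₘ φ| ≤ B` for every `m`. -/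
def HermiteBound (q : ℕ) (φ : 𝓢(ℝ, ℂ)) (B : ℝ) : Prop :=
  ∀ m : ℕ, ((m : ℝ) + 1) ^ q * ‖hermiteCoeff m φ‖ ≤ B

theorem HermiteBound.nonneg {q : ℕ} {φ : 𝓢(ℝ, ℂ)} {B : ℝ} (h : HermiteBound q φ B) : 0 ≤ B :=
  le_trans (by positivity) (h 0)

theorem HermiteBound.anti {q q' : ℕ} {φ : 𝓢(ℝ, ℂ)} {B : ℝ} (h : HermiteBound q φ B)
    (hq : q' ≤ q) : HermiteBound q' φ B := fun m => by
  refine le_trans ?_ (h m)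
  gcongr
  linarith [(m.cast_nonneg : (0 : ℝ) ≤ m)]

theorem sqrt_two_mul_le (m : ℕ) : √(2 * ((m : ℝ) + 1)) ≤ 2 * ((m : ℝ) + 1) := by
  have hm : (0 : ℝ) ≤ m := m.cast_nonneg
  rw [Real.sqrt_le_left (by positivity)]
  nlinarith

theorem HermiteBound.annihilationOp {q : ℕ} {φ : 𝓢(ℝ, ℂ)} {B : ℝ}
    (h : HermiteBound (q + 1) φ B) : HermiteBound q (annihilationOp φ) (2 ^ (q + 1) * B) := by
  intro m
  have hm : (0 : ℝ) ≤ m := m.cast_nonneg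
  have h1 := h (m + 1)
  rw [hermiteCoeff_annihilationOp, norm_mul, Complex.norm_real, Real.norm_eq_abs,
    abs_of_nonneg (Real.sqrt_nonneg _)]
  calc ((m : ℝ) + 1) ^ q * (√(2 * (m + 1)) * ‖hermiteCoeff (m + 1) φ‖)
      ≤ ((m : ℝ) + 1 + 1) ^ q * ((2 * (m + 1 + 1)) * ‖hermiteCoeff (m + 1) φ‖) := by
        gcongr
        · linarith
        · exact (sqrt_two_mul_le m).trans (by linarith)
    _ = 2 * ((((m + 1 : ℕ) : ℝ) + 1) ^ (q + 1) * ‖hermiteCoeff (m + 1) φ‖) := by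
        push_cast; ring
    _ ≤ 2 ^ (q + 1) * B := by
        have := h.nonneg
        gcongr
        exact le_self_pow₀ (by norm_num) (by omega)

theorem HermiteBound.creationOp {q : ℕ} {φ : 𝓢(ℝ, ℂ)} {B : ℝ}
    (h : HermiteBound (q + 1) φ B) : HermiteBound q (creationOp φ) (2 ^ (q + 1) * B) := by
  intro m
  have hB := h.nonneg
  cases m with
  | zero => rw [hermiteCoeff_creationOp_zero, norm_zero, mul_zero]; positivity
  | succ m =>
    have hm : (0 : ℝ) ≤ m := m.cast_nonneg
    rw [hermiteCoeff_creationOp_succ, norm_mul, Complex.norm_real, Real.norm_eq_abs,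
      abs_of_nonneg (Real.sqrt_nonneg _)]
    push_cast
    calc ((m : ℝ) + 1 + 1) ^ q * (√(2 * (m + 1)) * ‖hermiteCoeff m φ‖)
        ≤ (2 * ((m : ℝ) + 1)) ^ q * ((2 * (m + 1)) * ‖hermiteCoeff m φ‖) := by
          gcongr
          · linarith
          · exact sqrt_two_mul_le m
      _ = 2 ^ (q + 1) * (((m : ℝ) + 1) ^ (q + 1) * ‖hermiteCoeff m φ‖) := by rw [mul_pow]; ring
      _ ≤ 2 ^ (q + 1) * B := by
          gcongr
          exact h m

theorem HermiteBound.mulCoord {q : ℕ} {φ : 𝓢(ℝ, ℂ)} {B : ℝ}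
    (h : HermiteBound (q + 1) φ B) : HermiteBound q (mulCoord φ) (2 ^ (q + 1) * B) := by
  intro m
  have h1 := h.annihilationOp m
  have h2 := h.creationOp m
  rw [mulCoord_eq, map_smul, map_add, norm_smul, norm_inv, Complex.norm_ofNat]
  have h3 := norm_add_le (hermiteCoeff m (_root_.annihilationOp φ))
    (hermiteCoeff m (_root_.creationOp φ))
  have h4 : (0 : ℝ) ≤ ((m : ℝ) + 1) ^ q := by positivity
  nlinarith [mul_le_mul_of_nonneg_left h3 h4]

theorem HermiteBound.derivCLM {q : ℕ} {φ : 𝓢(ℝ, ℂ)} {B : ℝ}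
    (h : HermiteBound (q + 1) φ B) :
    HermiteBound q (SchwartzMap.derivCLM ℂ ℂ φ) (2 ^ (q + 1) * B) := by
  intro m
  have h1 := h.annihilationOp m
  have h2 := h.creationOp m
  rw [derivCLM_eq, map_smul, map_sub, norm_smul, norm_inv, Complex.norm_ofNat]
  have h3 := norm_sub_le (hermiteCoeff m (_root_.annihilationOp φ))
    (hermiteCoeff m (_root_.creationOp φ))
  have h4 : (0 : ℝ) ≤ ((m : ℝ) + 1) ^ q := by positivity
  nlinarith [mul_le_mul_of_nonneg_left h3 h4]

theorem summable_inv_add_one_sq : Summable fun m : ℕ => (((m : ℝ) + 1) ^ 2)⁻¹ := by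
  have := (summable_nat_add_iff 1).2 (Real.summable_nat_pow_inv.2 one_lt_two)
  simpa using this

theorem hasSum_norm_hermiteCoeff_sq (φ : 𝓢(ℝ, ℂ)) :
    HasSum (fun m => ‖hermiteCoeff m φ‖ ^ 2) (‖φ.toLp 2 (volume : Measure ℝ)‖ ^ 2) := by
  have h := hermiteBasis.hasSum_inner_mul_inner (φ.toLp 2 (volume : Measure ℝ))
    (φ.toLp 2 (volume : Measure ℝ))
  rw [inner_self_eq_norm_sq_to_K] at h
  have hterm : ∀ m, ⟪φ.toLp 2 (volume : Measure ℝ), hermiteBasis m⟫_ℂ *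
      ⟪hermiteBasis m, φ.toLp 2 (volume : Measure ℝ)⟫_ℂ = ((‖hermiteCoeff m φ‖ ^ 2 : ℝ) : ℂ) := by
    intro m
    rw [← inner_conj_symm, hermiteBasis_apply, inner_hermiteL2_toLp, Complex.conj_mul',
      Complex.ofReal_pow]
  simp only [hterm] at h
  refine Complex.hasSum_ofReal.1 ?_
  rw [Complex.ofReal_pow]
  exact h

theorem norm_toLp_le_of_hermiteBound :
    ∃ C : ℝ, 0 ≤ C ∧ ∀ (φ : 𝓢(ℝ, ℂ)) (B : ℝ), HermiteBound 1 φ B →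
      ‖φ.toLp 2 (volume : Measure ℝ)‖ ^ 2 ≤ C * B ^ 2 := by
  refine ⟨∑' m : ℕ, (((m : ℝ) + 1) ^ 2)⁻¹, tsum_nonneg fun m => by positivity, fun φ B h => ?_⟩
  rw [← (hasSum_norm_hermiteCoeff_sq φ).tsum_eq, ← tsum_mul_right]
  refine (hasSum_norm_hermiteCoeff_sq φ).summable.tsum_le_tsum (fun m => ?_)
    (summable_inv_add_one_sq.mul_right _)
  have h1 := h m
  have hm : (0 : ℝ) < (m : ℝ) + 1 := by positivity
  rw [inv_mul_eq_div, le_div_iff₀ (by positivity), ← mul_pow]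
  rw [pow_one, mul_comm] at h1
  gcongr

theorem SchwartzMap.integral_norm_sq (φ : 𝓢(ℝ, ℂ)) :
    ∫ t, ‖φ t‖ ^ 2 = ‖φ.toLp 2 (volume : Measure ℝ)‖ ^ 2 := by
  rw [SchwartzMap.norm_toLp' (by simp) (by simp)]
  have h : 0 ≤ ∫ t, ‖φ t‖ ^ 2 := integral_nonneg fun t => by positivity
  simp only [ENNReal.toReal_ofNat, Real.rpow_ofNat]
  rw [← Real.rpow_natCast, ← Real.rpow_mul h]
  norm_num

/-- The one-dimensional Sobolev inequality for Schwartz functions, obtained by integrating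
`(φ²)' = 2 φ φ'` over `(-∞, x]`. -/
theorem SchwartzMap.norm_sq_le_add (φ : 𝓢(ℝ, ℂ)) (x : ℝ) :
    ‖φ x‖ ^ 2 ≤ ‖φ.toLp 2 (volume : Measure ℝ)‖ ^ 2 +
      ‖(SchwartzMap.derivCLM ℂ ℂ φ).toLp 2 (volume : Measure ℝ)‖ ^ 2 := by
  set ψ := SchwartzMap.derivCLM ℂ ℂ φ with hψ
  have hint : Integrable fun t => 2 * (φ t * ψ t) := (SchwartzMap.integrable_mul φ ψ).const_mul 2
  have hderiv : ∀ t, HasDerivAt (fun s => φ s * φ s) (2 * (φ t * ψ t)) t := fun t => by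
    have := (φ.hasDerivAt t).mul (φ.hasDerivAt t)
    refine this.congr_deriv ?_
    rw [hψ, SchwartzMap.derivCLM_apply]
    ring
  have hlim : Tendsto (fun s => φ s * φ s) atBot (𝓝 0) := by
    have h := φ.tendsto_cocompact.mono_left _root_.atBot_le_cocompact
    simpa using h.mul h
  have h1 := integral_Iic_of_hasDerivAt_of_tendsto (a := x) (hderiv x).continuousAt.continuousWithinAt
    (fun t _ => hderiv t) hint.integrableOn hlim
  have hsq : ∀ χ : 𝓢(ℝ, ℂ), Integrable fun t => ‖χ t‖ ^ 2 := fun χ =>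
    (memLp_two_iff_integrable_sq_norm χ.continuous.aestronglyMeasurable).1 (χ.memLp 2)
  rw [sub_zero] at h1
  calc ‖φ x‖ ^ 2 = ‖φ x * φ x‖ := by rw [norm_mul, sq]
    _ = ‖∫ t in Iic x, 2 * (φ t * ψ t)‖ := by rw [h1]
    _ ≤ ∫ t in Iic x, ‖2 * (φ t * ψ t)‖ := norm_integral_le_integral_norm _
    _ ≤ ∫ t, ‖2 * (φ t * ψ t)‖ :=
        setIntegral_le_integral hint.norm (Eventually.of_forall fun t => norm_nonneg _)
    _ ≤ ∫ t, (‖φ t‖ ^ 2 + ‖ψ t‖ ^ 2) := by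
        refine integral_mono hint.norm ((hsq φ).add (hsq ψ)) fun t => ?_
        simp only [norm_mul, Complex.norm_ofNat]
        nlinarith [sq_nonneg (‖φ t‖ - ‖ψ t‖)]
    _ = _ := by rw [integral_add (hsq φ) (hsq ψ), SchwartzMap.integral_norm_sq,
        SchwartzMap.integral_norm_sq]

theorem norm_apply_le_of_hermiteBound :
    ∃ C : ℝ, 0 ≤ C ∧ ∀ (φ : 𝓢(ℝ, ℂ)) (B : ℝ), HermiteBound 2 φ B → ∀ x, ‖φ x‖ ≤ C * B := by
  obtain ⟨C, hC, h⟩ := norm_toLp_le_of_hermiteBound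
  refine ⟨√(17 * C), Real.sqrt_nonneg _, fun φ B hB x => ?_⟩
  have h1 := h φ B (hB.anti one_le_two)
  have h2 := h _ _ hB.derivCLM
  have h3 := φ.norm_sq_le_add x
  refine abs_le_of_sq_le_sq' ?_ (mul_nonneg (Real.sqrt_nonneg _) hB.nonneg) |>.2
  rw [mul_pow, Real.sq_sqrt (by positivity)]
  norm_num at h2
  nlinarith

theorem HermiteBound.mulCoord_iterate {q k : ℕ} {φ : 𝓢(ℝ, ℂ)} {B : ℝ}
    (h : HermiteBound (q + k) φ B) :
    HermiteBound q (_root_.mulCoord^[k] φ) ((2 ^ (q + k)) ^ k * B) := by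
  induction k generalizing q with
  | zero => simpa using h
  | succ k ih =>
    rw [Function.iterate_succ_apply']
    have h1 : HermiteBound (q + 1 + k) φ B := by rwa [add_assoc, add_comm 1 k]
    have h2 := (ih h1).mulCoord
    intro m
    refine (h2 m).trans ?_
    have hB := h.nonneg
    rw [pow_succ' _ k, ← mul_assoc, show q + 1 + k = q + (k + 1) by ring]
    gcongr
    · norm_num
    · omega

theorem HermiteBound.derivCLM_iterate {q k : ℕ} {φ : 𝓢(ℝ, ℂ)} {B : ℝ}
    (h : HermiteBound (q + k) φ B) :
    HermiteBound q ((SchwartzMap.derivCLM ℂ ℂ)^[k] φ) ((2 ^ (q + k)) ^ k * B) := by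
  induction k generalizing q with
  | zero => simpa using h
  | succ k ih =>
    rw [Function.iterate_succ_apply']
    have h1 : HermiteBound (q + 1 + k) φ B := by rwa [add_assoc, add_comm 1 k]
    have h2 := (ih h1).derivCLM
    intro m
    refine (h2 m).trans ?_
    have hB := h.nonneg
    rw [pow_succ' _ k, ← mul_assoc, show q + 1 + k = q + (k + 1) by ring]
    gcongr
    · norm_num
    · omega

theorem SchwartzMap.derivCLM_iterate_coe (l : ℕ) (φ : 𝓢(ℝ, ℂ)) :
    (((SchwartzMap.derivCLM ℂ ℂ)^[l] φ : 𝓢(ℝ, ℂ)) : ℝ → ℂ) = iteratedDeriv l φ := by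
  induction l with
  | zero => simp
  | succ l ih =>
    funext x
    rw [Function.iterate_succ_apply', SchwartzMap.derivCLM_apply, ih, iteratedDeriv_succ]

/-- Every Schwartz seminorm is dominated by a weighted supremum of the Hermite coefficients. -/
theorem seminorm_le_of_hermiteBound (k l : ℕ) :
    ∃ C : ℝ, 0 ≤ C ∧ ∀ (φ : 𝓢(ℝ, ℂ)) (B : ℝ), HermiteBound (2 + k + l) φ B →
      SchwartzMap.seminorm ℂ k l φ ≤ C * B := by
  obtain ⟨C, hC, h⟩ := norm_apply_le_of_hermiteBound
  refine ⟨C * ((2 ^ (2 + k)) ^ k * (2 ^ (2 + k + l)) ^ l), by positivity, fun φ B hB => ?_⟩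
  have h1 := h _ _ hB.derivCLM_iterate.mulCoord_iterate
  have hB0 := hB.nonneg
  refine SchwartzMap.seminorm_le_bound' ℂ k l φ (by positivity) fun x => ?_
  have h2 := h1 x
  rw [mulCoord_iterate_apply, SchwartzMap.derivCLM_iterate_coe, norm_mul, norm_pow,
    Complex.norm_real, Real.norm_eq_abs] at h2
  linarith

theorem finset_sup_seminorm_le_of_hermiteBound (s : Finset (ℕ × ℕ)) :
    ∃ (q : ℕ) (C : ℝ), 0 ≤ C ∧ ∀ (φ : 𝓢(ℝ, ℂ)) (B : ℝ), HermiteBound q φ B →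
      (s.sup (schwartzSeminormFamily ℂ ℝ ℂ)) φ ≤ C * B := by
  choose C hC h using seminorm_le_of_hermiteBound
  refine ⟨s.sup fun p => 2 + p.1 + p.2, ∑ p ∈ s, C p.1 p.2, Finset.sum_nonneg fun p _ => hC _ _,
    fun φ B hB => ?_⟩
  have hB0 := hB.nonneg
  refine Seminorm.finset_sup_apply_le (mul_nonneg (Finset.sum_nonneg fun p _ => hC _ _) hB0)
    fun p hp => ?_
  refine (h p.1 p.2 φ B (hB.anti (Finset.le_sup (f := fun p : ℕ × ℕ => 2 + p.1 + p.2) hp))).trans ?_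
  gcongr
  exact Finset.single_le_sum (f := fun p : ℕ × ℕ => C p.1 p.2) (fun p _ => hC _ _) hp

theorem exists_norm_le_of_hermiteBound (T : 𝓢(ℝ, ℂ) →L[ℂ] ℂ) :
    ∃ (q : ℕ) (C : ℝ), 0 ≤ C ∧ ∀ (φ : 𝓢(ℝ, ℂ)) (B : ℝ), HermiteBound q φ B → ‖T φ‖ ≤ C * B := by
  obtain ⟨s, D, hD⟩ := SchwartzMap.exists_bound_of_pointwise_bounded (fun _ : Unit => T)
    fun φ => ⟨‖T φ‖, fun _ => le_rfl⟩
  obtain ⟨q, C, hC, h⟩ := finset_sup_seminorm_le_of_hermiteBound s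
  refine ⟨q, |D| * C, by positivity, fun φ B hB => (hD () φ).trans ?_⟩
  rw [mul_assoc]
  refine mul_le_mul (le_abs_self D) (h φ B hB) (apply_nonneg _ _) (abs_nonneg D)

/-- The shifted number operator, with eigenvalue `m + 1` on the `m`-th Hermite function. -/
noncomputable def numberOp : 𝓢(ℝ, ℂ) →L[ℂ] 𝓢(ℝ, ℂ) :=
  (2⁻¹ : ℂ) • (creationOp ∘L annihilationOp) + ContinuousLinearMap.id ℂ _

theorem hermiteCoeff_numberOp (m : ℕ) (φ : 𝓢(ℝ, ℂ)) :
    hermiteCoeff m (numberOp φ) = ((m : ℂ) + 1) * hermiteCoeff m φ := by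
  have h : numberOp φ = (2⁻¹ : ℂ) • creationOp (annihilationOp φ) + φ := rfl
  rw [h, map_add, map_smul]
  cases m with
  | zero => simp [hermiteCoeff_creationOp_zero]
  | succ m =>
    have hs : ((√(2 * ((m : ℝ) + 1)) : ℝ) : ℂ) * ((√(2 * ((m : ℝ) + 1)) : ℝ) : ℂ) =
        2 * ((m : ℂ) + 1) := by
      rw [← Complex.ofReal_mul, Real.mul_self_sqrt (by positivity)]
      push_cast
      rfl
    rw [hermiteCoeff_creationOp_succ, hermiteCoeff_annihilationOp, smul_eq_mul,
      ← mul_assoc (((√(2 * ((m : ℝ) + 1)) : ℝ) : ℂ)), hs]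
    push_cast
    ring

/-- The Hermite coefficients of a Schwartz function decay rapidly: multiplying them by `(m + 1)^q`
amounts to applying a power of the number operator. -/
theorem exists_hermiteBound (q : ℕ) (φ : 𝓢(ℝ, ℂ)) : ∃ B, HermiteBound q φ B := by
  refine ⟨‖((numberOp ^ q) φ).toLp 2 (volume : Measure ℝ)‖, fun m => ?_⟩
  have h1 : ∀ ψ : 𝓢(ℝ, ℂ), ‖hermiteCoeff m ψ‖ ≤ ‖ψ.toLp 2 (volume : Measure ℝ)‖ := fun ψ => by
    rw [← inner_hermiteL2_toLp]
    refine (norm_inner_le_norm _ _).trans ?_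
    rw [orthonormal_hermiteL2.1 m, one_mul]
  have h2 : hermiteCoeff m ((numberOp ^ q) φ) = ((m : ℂ) + 1) ^ q * hermiteCoeff m φ := by
    induction q with
    | zero => simp
    | succ q ih =>
      rw [pow_succ', mul_apply_eq_comp, hermiteCoeff_numberOp, ih]
      ring
  refine le_trans (le_of_eq ?_) (h1 ((numberOp ^ q) φ))
  rw [h2, norm_mul, norm_pow]
  congr 2
  rw [← Complex.ofReal_natCast, ← Complex.ofReal_one, ← Complex.ofReal_add, Complex.norm_real,
    Real.norm_of_nonneg (by positivity)]

theorem hermiteBound_hermiteSchwartz (q n : ℕ) :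
    HermiteBound q (hermiteSchwartz n) (((n : ℝ) + 1) ^ q) := fun m => by
  rw [hermiteCoeff_hermiteSchwartz]
  by_cases h : m = n
  · simp [h]
  · rw [if_neg h, norm_zero, mul_zero]
    positivity

/-- A continuous functional has polynomially growing values on the Hermite functions. -/
theorem exists_norm_apply_hermiteSchwartz_le (T : 𝓢(ℝ, ℂ) →L[ℂ] ℂ) :
    ∃ (q : ℕ) (C : ℝ), 0 ≤ C ∧ ∀ m, ‖T (hermiteSchwartz m)‖ ≤ C * ((m : ℝ) + 1) ^ q := by
  obtain ⟨q, C, hC, h⟩ := exists_norm_le_of_hermiteBound T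
  exact ⟨q, C, hC, fun m => h _ _ (hermiteBound_hermiteSchwartz q m)⟩

/-- The Hermite expansion of a Schwartz function converges in the Schwartz space, so a continuous
functional may be applied term by term. -/
theorem hasSum_hermiteCoeff_mul (T : 𝓢(ℝ, ℂ) →L[ℂ] ℂ) (φ : 𝓢(ℝ, ℂ)) :
    HasSum (fun m => hermiteCoeff m φ * T (hermiteSchwartz m)) (T φ) := by
  have hsum : Summable fun m => hermiteCoeff m φ * T (hermiteSchwartz m) := by
    obtain ⟨q, C, hC, h⟩ := exists_norm_apply_hermiteSchwartz_le T
    obtain ⟨B, hB⟩ := exists_hermiteBound (q + 2) φ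
    refine Summable.of_norm_bounded (summable_inv_add_one_sq.mul_left (B * C)) fun m => ?_
    have hm : (0 : ℝ) < (m : ℝ) + 1 := by positivity
    rw [norm_mul, ← div_eq_mul_inv, le_div_iff₀ (by positivity)]
    calc ‖hermiteCoeff m φ‖ * ‖T (hermiteSchwartz m)‖ * ((m : ℝ) + 1) ^ 2
        ≤ ‖hermiteCoeff m φ‖ * (C * ((m : ℝ) + 1) ^ q) * ((m : ℝ) + 1) ^ 2 := by
          gcongr
          exact h m
      _ = (((m : ℝ) + 1) ^ (q + 2) * ‖hermiteCoeff m φ‖) * C := by ring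
      _ ≤ B * C := by
          gcongr
          exact hB m
  refine (hsum.hasSum_iff_tendsto_nat).2 ?_
  obtain ⟨q, C, hC, h⟩ := exists_norm_le_of_hermiteBound T
  obtain ⟨B, hB⟩ := exists_hermiteBound (q + 1) φ
  have hrem : ∀ N : ℕ, HermiteBound q
      (∑ m ∈ Finset.range N, hermiteCoeff m φ • hermiteSchwartz m - φ) (B / ((N : ℝ) + 1)) := by
    intro N m
    have hc : hermiteCoeff m (∑ i ∈ Finset.range N, hermiteCoeff i φ • hermiteSchwartz i) =
        if m < N then hermiteCoeff m φ else 0 := by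
      simp [map_sum, hermiteCoeff_hermiteSchwartz]
    have hB0 := hB.nonneg
    rw [map_sub, hc]
    split_ifs with hmN
    · rw [sub_self, norm_zero, mul_zero]
      positivity
    · rw [zero_sub, norm_neg, le_div_iff₀ (by positivity)]
      refine le_trans ?_ (hB m)
      have : (N : ℝ) ≤ m := by exact_mod_cast not_lt.1 hmN
      rw [pow_succ, mul_assoc, mul_assoc, mul_comm ‖_‖]
      gcongr
  rw [tendsto_iff_norm_sub_tendsto_zero]
  refine squeeze_zero (fun _ => norm_nonneg _) (fun N => ?_)
    (g := fun N : ℕ => C * (B / ((N : ℝ) + 1))) ?_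
  · have := h _ _ (hrem N)
    rw [map_sub, map_sum] at this
    simpa only [map_smul, smul_eq_mul] using this
  · have := (tendsto_const_div_atTop_nhds_zero_nat B).comp (tendsto_add_atTop_nat 1)
    have h2 := this.const_mul C
    simp only [mul_zero] at h2
    refine h2.congr fun N => ?_
    simp

/-! ### Infinite matrices with off-diagonal decay -/

section Schur

open scoped ENNReal

theorem ENNReal.tsum_mul_sq_le (w a : ℕ → ℝ≥0∞) :
    (∑' m, w m * a m) ^ 2 ≤ (∑' m, w m) * ∑' m, w m * a m ^ 2 := by
  have h : ∑' m, w m * a m ≤ (∑' m, w m) ^ (1 / 2 : ℝ) * (∑' m, w m * a m ^ 2) ^ (1 / 2 : ℝ) := by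
    refine ENNReal.tsum_le_of_sum_range_le fun N => ?_
    have h1 := ENNReal.inner_le_weight_mul_Lp_of_nonneg (Finset.range N) (p := 2) one_le_two w a
    refine h1.trans ?_
    rw [show (1 - (2 : ℝ)⁻¹) = 1 / 2 by norm_num, show ((2 : ℝ)⁻¹) = 1 / 2 by norm_num]
    simp only [ENNReal.rpow_two]
    gcongr
    · exact ENNReal.sum_le_tsum _
    · exact ENNReal.sum_le_tsum _
  calc (∑' m, w m * a m) ^ 2
      ≤ ((∑' m, w m) ^ (1 / 2 : ℝ) * (∑' m, w m * a m ^ 2) ^ (1 / 2 : ℝ)) ^ 2 := by gcongr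
    _ = (∑' m, w m) * ∑' m, w m * a m ^ 2 := by
      rw [mul_pow, ← ENNReal.rpow_two, ← ENNReal.rpow_two, ← ENNReal.rpow_mul, ← ENNReal.rpow_mul]
      norm_num

/-- The Schur test on `ℓ²(ℕ)`. -/
theorem ENNReal.tsum_sq_tsum_mul_le {k : ℕ → ℕ → ℝ≥0∞} {M : ℝ≥0∞} (hrow : ∀ n, ∑' m, k n m ≤ M)
    (hcol : ∀ m, ∑' n, k n m ≤ M) (a : ℕ → ℝ≥0∞) :
    ∑' n, (∑' m, k n m * a m) ^ 2 ≤ M ^ 2 * ∑' m, a m ^ 2 :=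
  calc ∑' n, (∑' m, k n m * a m) ^ 2 ≤ ∑' n, M * ∑' m, k n m * a m ^ 2 :=
        ENNReal.tsum_le_tsum fun n => (ENNReal.tsum_mul_sq_le _ _).trans (by gcongr; exact hrow n)
    _ = M * ∑' m, (∑' n, k n m) * a m ^ 2 := by
        rw [ENNReal.tsum_mul_left, ENNReal.tsum_comm]
        simp only [ENNReal.tsum_mul_right]
    _ ≤ M * ∑' m, M * a m ^ 2 := by gcongr with m; exact hcol m
    _ = M ^ 2 * ∑' m, a m ^ 2 := by rw [ENNReal.tsum_mul_left, ← mul_assoc, sq]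

end Schur

/-- The constant `∑_{j ∈ ℤ} (1 + |j|)⁻²`, which bounds the row and column sums of the matrix
`(1 + |n - m|)⁻²`. -/
noncomputable def schurConst : ℝ := ∑' j : ℤ, ((1 + |(j : ℝ)|) ^ 2)⁻¹

theorem summable_schurConst : Summable fun j : ℤ => ((1 + |(j : ℝ)|) ^ 2)⁻¹ := by
  have h : Summable fun n : ℕ => ((1 + (n : ℝ)) ^ 2)⁻¹ := by
    simpa only [add_comm] using summable_inv_add_one_sq
  refine Summable.of_nat_of_neg ?_ ?_ <;> simpa using h

theorem one_le_schurConst : 1 ≤ schurConst := by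
  have := summable_schurConst.le_tsum 0 fun j _ => by positivity
  simpa [schurConst] using this

theorem summable_offDiag (n : ℕ) : Summable fun m : ℕ => ((1 + |(n : ℝ) - m|) ^ 2)⁻¹ := by
  have hinj : Function.Injective fun m : ℕ => (n : ℤ) - m := fun a b h => by
    simpa using h
  simpa [Function.comp_def] using summable_schurConst.comp_injective hinj

theorem tsum_offDiag_le (n : ℕ) : ∑' m : ℕ, ((1 + |(n : ℝ) - m|) ^ 2)⁻¹ ≤ schurConst := by
  have hinj : Function.Injective fun m : ℕ => (n : ℤ) - m := fun a b h => by
    simpa using h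
  have := tsum_comp_le_tsum_of_inj summable_schurConst (fun j => by positivity) hinj
  simpa [Function.comp_def, schurConst] using this

theorem summable_offDiag_mul {c : ℝ} {K u : ℕ → ℂ} (n : ℕ)
    (hK : ∀ m : ℕ, (1 + |(n : ℝ) - m|) ^ 2 * ‖K m‖ ≤ c) (hu : Summable fun m => ‖u m‖ ^ 2) :
    Summable fun m => K m * u m := by
  have hc : 0 ≤ c := le_trans (by positivity) (hK 0)
  obtain ⟨U, hU⟩ : ∃ U : ℝ, ∀ m, ‖u m‖ ≤ U := by
    refine ⟨1 + ∑' m, ‖u m‖ ^ 2, fun m => ?_⟩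
    have := hu.le_tsum m fun j _ => by positivity
    nlinarith [sq_nonneg (‖u m‖ - 1)]
  refine Summable.of_norm_bounded ((summable_offDiag n).mul_left (c * U)) fun m => ?_
  have h2 : ‖K m‖ ≤ c * ((1 + |(n : ℝ) - m|) ^ 2)⁻¹ := by
    rw [← div_eq_mul_inv, le_div_iff₀ (by positivity), mul_comm]
    exact hK m
  rw [norm_mul, mul_right_comm]
  exact mul_le_mul h2 (hU m) (norm_nonneg _) (by positivity)

/-- The Schur test for matrices with quadratic off-diagonal decay. -/
theorem tsum_norm_tsum_mul_sq_le {c : ℝ} {K : ℕ → ℕ → ℂ} {u : ℕ → ℂ}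
    (hK : ∀ n m : ℕ, (1 + |(n : ℝ) - m|) ^ 2 * ‖K n m‖ ≤ c) (hu : Summable fun m => ‖u m‖ ^ 2) :
    (Summable fun n => ‖∑' m, K n m * u m‖ ^ 2) ∧
      ∑' n, ‖∑' m, K n m * u m‖ ^ 2 ≤ (c * schurConst) ^ 2 * ∑' m, ‖u m‖ ^ 2 := by
  have hc : 0 ≤ c := le_trans (by positivity) (hK 0 0)
  have hσ := one_le_schurConst
  have hbound : ∀ n m : ℕ, ‖K n m‖ ≤ c * ((1 + |(n : ℝ) - m|) ^ 2)⁻¹ := fun n m => by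
    rw [← div_eq_mul_inv, le_div_iff₀ (by positivity), mul_comm]
    exact hK n m
  have hrow : ∀ n : ℕ, ∑' m : ℕ, ENNReal.ofReal (c * ((1 + |(n : ℝ) - m|) ^ 2)⁻¹) ≤
      ENNReal.ofReal (c * schurConst) := fun n => by
    rw [← ENNReal.ofReal_tsum_of_nonneg (fun m => by positivity) ((summable_offDiag n).mul_left c),
      tsum_mul_left]
    exact ENNReal.ofReal_le_ofReal (mul_le_mul_of_nonneg_left (tsum_offDiag_le n) hc)
  have hcol : ∀ m : ℕ, ∑' n : ℕ, ENNReal.ofReal (c * ((1 + |(n : ℝ) - m|) ^ 2)⁻¹) ≤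
      ENNReal.ofReal (c * schurConst) := fun m => by
    refine le_trans (le_of_eq ?_) (hrow m)
    simp only [abs_sub_comm]
  have h := ENNReal.tsum_sq_tsum_mul_le hrow hcol fun m => ENNReal.ofReal ‖u m‖
  have hle : ∑' n, ENNReal.ofReal (‖∑' m, K n m * u m‖ ^ 2) ≤
      ENNReal.ofReal ((c * schurConst) ^ 2 * ∑' m, ‖u m‖ ^ 2) := by
    rw [ENNReal.ofReal_mul (by positivity), ENNReal.ofReal_tsum_of_nonneg (fun m => by positivity) hu,
      ENNReal.ofReal_pow (by positivity)]
    simp only [ENNReal.ofReal_pow (norm_nonneg _)]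
    refine le_trans (ENNReal.tsum_le_tsum fun n => ?_) h
    gcongr
    have hs := (summable_offDiag_mul n (hK n) hu).norm
    refine (ENNReal.ofReal_le_ofReal (norm_tsum_le_tsum_norm hs)).trans ?_
    rw [ENNReal.ofReal_tsum_of_nonneg (fun m => norm_nonneg _) hs]
    refine ENNReal.tsum_le_tsum fun m => ?_
    rw [norm_mul, ENNReal.ofReal_mul (norm_nonneg _)]
    gcongr
    exact hbound n m
  have hsum : Summable fun n => ‖∑' m, K n m * u m‖ ^ 2 := by
    have := ENNReal.summable_toReal (ne_top_of_le_ne_top ENNReal.ofReal_ne_top hle)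
    refine this.congr fun n => ENNReal.toReal_ofReal (by positivity)
  refine ⟨hsum, ?_⟩
  rw [← ENNReal.ofReal_tsum_of_nonneg (fun n => by positivity) hsum] at hle
  exact (ENNReal.ofReal_le_ofReal_iff (by positivity)).1 hle

/-! ### Weighted lower bounds for localized matrices -/

/-- A matrix bounded below on `ℓ²` stays bounded below on a weighted `ℓ²` space whose weight `ω`
varies so slowly that conjugation by `ω` changes the matrix by a small perturbation. -/
theorem weighted_lower_bound {E : ℕ → ℕ → ℂ} {A c : ℝ} (hc : (c * schurConst) ^ 2 ≤ A / 4)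
    (hlow : ∀ u : ℕ → ℂ, (Summable fun m => ‖u m‖ ^ 2) →
      A * ∑' m, ‖u m‖ ^ 2 ≤ ∑' n, ‖∑' m, E n m * u m‖ ^ 2)
    {ω : ℕ → ℝ} (hω : ∀ m, 0 < ω m)
    (hpert : ∀ n m : ℕ, (1 + |(n : ℝ) - m|) ^ 2 * (‖E n m‖ * |1 - ω n / ω m|) ≤ c)
    {τ t : ℕ → ℂ} (hτ : Summable fun m => ‖ω m * τ m‖ ^ 2)
    (ht : ∀ n, HasSum (fun m => E n m * τ m) (t n)) (hts : Summable fun n => ‖ω n * t n‖ ^ 2) :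
    A * ∑' m, ‖ω m * τ m‖ ^ 2 ≤ 4 * ∑' n, ‖ω n * t n‖ ^ 2 := by
  set u : ℕ → ℂ := fun m => ω m * τ m with hu
  set K : ℕ → ℕ → ℂ := fun n m => E n m * ((1 - ω n / ω m : ℝ) : ℂ) with hK
  have hK2 : ∀ n m : ℕ, (1 + |(n : ℝ) - m|) ^ 2 * ‖K n m‖ ≤ c := fun n m => by
    rw [hK, norm_mul, Complex.norm_real, Real.norm_eq_abs]
    exact hpert n m
  have hsplit : ∀ n, ∑' m, E n m * u m = ω n * t n + ∑' m, K n m * u m := by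
    intro n
    refine HasSum.tsum_eq ?_
    have h1 := ((ht n).mul_left (ω n : ℂ)).add (summable_offDiag_mul n (hK2 n) hτ).hasSum
    refine h1.congr_fun fun m => ?_
    have : (ω m : ℂ) ≠ 0 := Complex.ofReal_ne_zero.2 (hω m).ne'
    simp only [hK, hu]
    push_cast
    field_simp
    ring
  obtain ⟨hKs, hKle⟩ := tsum_norm_tsum_mul_sq_le hK2 hτ
  have h1 := hlow u hτ
  have h2 : ∑' n, ‖∑' m, E n m * u m‖ ^ 2 ≤
      2 * ∑' n, ‖ω n * t n‖ ^ 2 + 2 * ∑' n, ‖∑' m, K n m * u m‖ ^ 2 := by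
    rw [← tsum_mul_left, ← tsum_mul_left, ← (hts.mul_left 2).tsum_add (hKs.mul_left 2)]
    have hpt : ∀ n, ‖∑' m, E n m * u m‖ ^ 2 ≤
        2 * ‖ω n * t n‖ ^ 2 + 2 * ‖∑' m, K n m * u m‖ ^ 2 := fun n => by
      rw [hsplit]
      have := norm_add_le (ω n * t n : ℂ) (∑' m, K n m * u m)
      nlinarith [sq_nonneg (‖(ω n * t n : ℂ)‖ - ‖∑' m, K n m * u m‖),
        norm_nonneg ((ω n * t n : ℂ) + ∑' m, K n m * u m)]
    have hs := (hts.mul_left 2).add (hKs.mul_left 2)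
    exact (Summable.of_nonneg_of_le (fun n => by positivity) hpt hs).tsum_le_tsum hpt hs
  have h3 : (c * schurConst) ^ 2 * ∑' m, ‖u m‖ ^ 2 ≤ A / 4 * ∑' m, ‖u m‖ ^ 2 :=
    mul_le_mul_of_nonneg_right hc (tsum_nonneg fun m => by positivity)
  linarith

theorem one_add_mul_pow_sub_one_le {x d : ℝ} (hx0 : 0 ≤ x) (hx1 : x ≤ 1) (hd : 0 ≤ d) (p : ℕ) :
    (1 + x * d) ^ p - 1 ≤ x * (1 + d) ^ p := by
  have h : (1 + x * d) ^ p - 1 ≤ x * ((1 + d) ^ p - 1) := by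
    induction p with
    | zero => simp
    | succ p ih =>
      have h1 : 1 + x * d ≤ 1 + d := by nlinarith
      have h2 : 0 ≤ x * ((1 + d) ^ p - 1) :=
        mul_nonneg hx0 (sub_nonneg.2 (one_le_pow₀ (by linarith)))
      calc (1 + x * d) ^ (p + 1) - 1 = (1 + x * d) * ((1 + x * d) ^ p - 1) + x * d := by ring
        _ ≤ (1 + x * d) * (x * ((1 + d) ^ p - 1)) + x * d := by gcongr
        _ ≤ (1 + d) * (x * ((1 + d) ^ p - 1)) + x * d := by gcongr
        _ = x * ((1 + d) ^ (p + 1) - 1) := by ring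
  linarith

theorem one_add_mul_le_mul {x : ℝ} (hx : 0 ≤ x) (n m : ℕ) :
    1 + x * m ≤ (1 + x * n) * (1 + x * |(n : ℝ) - m|) := by
  have h1 : (m : ℝ) ≤ n + |(n : ℝ) - m| := by linarith [neg_abs_le ((n : ℝ) - m)]
  have h2 : 0 ≤ x * n * (x * |(n : ℝ) - m|) := by positivity
  nlinarith [mul_le_mul_of_nonneg_left h1 hx]

theorem abs_one_sub_div_le {a b q : ℝ} (ha : 0 < a) (hb : 0 < b) (h1 : a ≤ b * q)
    (h2 : b ≤ a * q) : |1 - a / b| ≤ q - 1 := by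
  have h3 : a / b ≤ q := by rwa [div_le_iff₀ hb, mul_comm]
  rw [abs_le]
  refine ⟨by linarith, ?_⟩
  have hq : 1 ≤ q := by
    by_contra h
    nlinarith
  rw [sub_le_comm, le_div_iff₀ hb]
  nlinarith [mul_nonneg (sub_nonneg.2 hq) ha.le]

/-- The weight `(1 + x m)^(-p) (1 + δ m)^(-K)`. The factor with `δ` makes polynomially growing
sequences square summable; it disappears in the limit `δ → 0`. -/
noncomputable def polyWeight (p K : ℕ) (x δ : ℝ) (m : ℕ) : ℝ :=
  ((1 + x * m) ^ p * (1 + δ * m) ^ K)⁻¹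

theorem polyWeight_pos {p K : ℕ} {x δ : ℝ} (hx : 0 ≤ x) (hδ : 0 ≤ δ) (m : ℕ) :
    0 < polyWeight p K x δ m := by
  unfold polyWeight
  positivity

theorem abs_one_sub_polyWeight_div_le {p K : ℕ} {x δ : ℝ} (hx : 0 ≤ x) (hx1 : x ≤ 1)
    (hδ : 0 ≤ δ) (hδ1 : δ ≤ 1) (n m : ℕ) :
    |1 - polyWeight p K x δ n / polyWeight p K x δ m| ≤
      x * (1 + |(n : ℝ) - m|) ^ p + δ * (1 + |(n : ℝ) - m|) ^ (p + K) := by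
  set d := |(n : ℝ) - m| with hd
  have hd0 : 0 ≤ d := abs_nonneg _
  have hW : ∀ n m : ℕ, (1 + x * m) ^ p * (1 + δ * m) ^ K ≤ (1 + x * n) ^ p * (1 + δ * n) ^ K *
      ((1 + x * |(n : ℝ) - m|) ^ p * (1 + δ * |(n : ℝ) - m|) ^ K) := fun n m => by
    rw [mul_mul_mul_comm, ← mul_pow, ← mul_pow]
    gcongr
    · exact one_add_mul_le_mul hx n m
    · exact one_add_mul_le_mul hδ n m
  have h1 := hW n m
  have h2 := hW m n
  rw [abs_sub_comm (m : ℝ) n] at h2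
  have h3 : polyWeight p K x δ n / polyWeight p K x δ m =
      ((1 + x * m) ^ p * (1 + δ * m) ^ K) / ((1 + x * n) ^ p * (1 + δ * n) ^ K) := by
    unfold polyWeight
    rw [div_eq_mul_inv, inv_inv, div_eq_mul_inv, mul_comm]
  rw [h3]
  refine (abs_one_sub_div_le (by positivity) (by positivity) h1 h2).trans ?_
  have h4 := one_add_mul_pow_sub_one_le hx hx1 hd0 p
  have h5 := one_add_mul_pow_sub_one_le hδ hδ1 hd0 K
  have h6 : (1 + x * d) ^ p ≤ (1 + d) ^ p := by
    gcongr
    nlinarith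
  have h7 : 0 ≤ (1 + δ * d) ^ K - 1 := sub_nonneg.2 (one_le_pow₀ (by nlinarith))
  calc (1 + x * d) ^ p * (1 + δ * d) ^ K - 1
      = ((1 + x * d) ^ p - 1) + (1 + x * d) ^ p * ((1 + δ * d) ^ K - 1) := by ring
    _ ≤ x * (1 + d) ^ p + (1 + d) ^ p * (δ * (1 + d) ^ K) := by gcongr
    _ = _ := by ring

/-- For a matrix `E` with polynomial off-diagonal decay of every order that is bounded below on
`ℓ²`, the solution `τ` of `E τ = t` inherits the growth of `t` up to one power, with a constant
independent of the a priori growth of `τ`. -/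
theorem growth_bound_of_localized {E : ℕ → ℕ → ℂ} {A : ℝ} (hA : 0 < A)
    (hloc : ∀ s : ℕ, ∃ C : ℝ, ∀ n m : ℕ, (1 + |(n : ℝ) - m|) ^ (s + 2) * ‖E n m‖ ≤ C)
    (hlow : ∀ u : ℕ → ℂ, (Summable fun m => ‖u m‖ ^ 2) →
      A * ∑' m, ‖u m‖ ^ 2 ≤ ∑' n, ‖∑' m, E n m * u m‖ ^ 2) (k : ℕ) :
    ∃ M : ℝ, 0 ≤ M ∧ ∀ (τ t : ℕ → ℂ) (q : ℕ) (D B : ℝ),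
      (∀ m : ℕ, ‖τ m‖ ≤ D * ((m : ℝ) + 1) ^ q) → (∀ n, HasSum (fun m => E n m * τ m) (t n)) →
      (∀ n : ℕ, ‖t n‖ ≤ B * ((n : ℝ) + 1) ^ k) →
      ∀ m : ℕ, ‖τ m‖ ≤ M * B * ((m : ℝ) + 1) ^ (k + 1) := by
  have hσ := one_le_schurConst
  obtain ⟨C₁, hC₁⟩ := hloc (k + 1)
  have hC₁0 : 0 ≤ C₁ := le_trans (by positivity) (hC₁ 0 0)
  -- `c` is the size of perturbation allowed by the lower bound `A`.
  set c : ℝ := √A / (2 * schurConst) with hcdef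
  have hc0 : 0 < c := div_pos (Real.sqrt_pos.2 hA) (by positivity)
  have hc : (c * schurConst) ^ 2 ≤ A / 4 := by
    have : c * schurConst = √A / 2 := by
      rw [hcdef]
      field_simp
    rw [this, div_pow, Real.sq_sqrt hA.le]
    norm_num
  obtain ⟨x, hx0, hx1, hxC⟩ : ∃ x : ℝ, 0 < x ∧ x ≤ 1 ∧ x * C₁ ≤ c / 2 := by
    refine ⟨min 1 (c / 2 / (C₁ + 1)), by positivity, min_le_left _ _, ?_⟩
    calc min 1 (c / 2 / (C₁ + 1)) * C₁ ≤ c / 2 / (C₁ + 1) * (C₁ + 1) := by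
          gcongr
          · exact min_le_right _ _
          · linarith
      _ = c / 2 := by field_simp
  set ζ : ℝ := ∑' m : ℕ, (((m : ℝ) + 1) ^ 2)⁻¹ with hζ
  have hζ0 : 0 ≤ ζ := tsum_nonneg fun m => by positivity
  refine ⟨√(4 * ζ / A) * (x ^ (k + 1))⁻¹, by positivity, fun τ t q D B hτ ht hB m => ?_⟩
  have hD : 0 ≤ D := by simpa using (norm_nonneg _).trans (hτ 0)
  have hB0 : 0 ≤ B := by simpa using (norm_nonneg _).trans (hB 0)
  obtain ⟨C₂, hC₂⟩ := hloc (k + 1 + (q + 1))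
  have hC₂0 : 0 ≤ C₂ := le_trans (by positivity) (hC₂ 0 0)
  have main : ∀ δ : ℝ, 0 < δ → δ ≤ 1 → δ * C₂ ≤ c / 2 →
      ‖τ m‖ ≤ √(4 * ζ / A) * (x ^ (k + 1))⁻¹ * B *
        ((1 + x * m) ^ (k + 1) * (1 + δ * m) ^ (q + 1)) := by
    intro δ hδ0 hδ1 hδC
    set ω := polyWeight (k + 1) (q + 1) x δ with hω
    have hωpos : ∀ m, 0 < ω m := polyWeight_pos hx0.le hδ0.le
    have hpert : ∀ n m : ℕ, (1 + |(n : ℝ) - m|) ^ 2 * (‖E n m‖ * |1 - ω n / ω m|) ≤ c := by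
      intro n m
      have h1 := abs_one_sub_polyWeight_div_le (p := k + 1) (K := q + 1) hx0.le hx1 hδ0.le hδ1 n m
      calc (1 + |(n : ℝ) - m|) ^ 2 * (‖E n m‖ * |1 - ω n / ω m|)
          ≤ (1 + |(n : ℝ) - m|) ^ 2 * (‖E n m‖ * (x * (1 + |(n : ℝ) - m|) ^ (k + 1) +
              δ * (1 + |(n : ℝ) - m|) ^ (k + 1 + (q + 1)))) := by gcongr
        _ = x * ((1 + |(n : ℝ) - m|) ^ (k + 1 + 2) * ‖E n m‖) +
            δ * ((1 + |(n : ℝ) - m|) ^ (k + 1 + (q + 1) + 2) * ‖E n m‖) := by ring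
        _ ≤ x * C₁ + δ * C₂ := by
            gcongr
            · exact hC₁ n m
            · exact hC₂ n m
        _ ≤ c := by linarith
    have hsq : ∀ a : ℝ, Summable fun m : ℕ => a ^ 2 * (((m : ℝ) + 1) ^ 2)⁻¹ :=
      fun a => summable_inv_add_one_sq.mul_left _
    have hlower : ∀ y : ℝ, 0 < y → y ≤ 1 → ∀ m : ℕ, y * ((m : ℝ) + 1) ≤ 1 + y * m :=
      fun y _ hy1 m => by linarith
    have hone : ∀ y : ℝ, 0 < y → ∀ (m p : ℕ), 1 ≤ (1 + y * (m : ℝ)) ^ p := fun y hy m p =>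
      one_le_pow₀ (le_add_of_nonneg_right (by positivity))
    have hωτ : ∀ m : ℕ, ‖ω m * τ m‖ ^ 2 ≤ (D * (δ ^ (q + 1))⁻¹) ^ 2 * (((m : ℝ) + 1) ^ 2)⁻¹ := by
      intro m
      rw [← inv_pow ((m : ℝ) + 1), ← mul_pow]
      gcongr
      rw [norm_mul, Complex.norm_real, Real.norm_of_nonneg (hωpos m).le, hω, polyWeight,
        inv_mul_eq_div, div_le_iff₀ (by positivity)]
      have h1 := hlower δ hδ0 hδ1 m
      calc ‖τ m‖ ≤ D * ((m : ℝ) + 1) ^ q := hτ m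
        _ = D * (δ ^ (q + 1))⁻¹ * ((m : ℝ) + 1)⁻¹ * (1 * (δ * ((m : ℝ) + 1)) ^ (q + 1)) := by
            field_simp
            rw [mul_pow]
            ring
        _ ≤ _ := by
            gcongr
            exact hone x hx0 m _
    have hωt : ∀ n : ℕ, ‖ω n * t n‖ ^ 2 ≤ (B * (x ^ (k + 1))⁻¹) ^ 2 * (((n : ℝ) + 1) ^ 2)⁻¹ := by
      intro n
      rw [← inv_pow ((n : ℝ) + 1), ← mul_pow]
      gcongr
      rw [norm_mul, Complex.norm_real, Real.norm_of_nonneg (hωpos n).le, hω, polyWeight,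
        inv_mul_eq_div, div_le_iff₀ (by positivity)]
      have h1 := hlower x hx0 hx1 n
      calc ‖t n‖ ≤ B * ((n : ℝ) + 1) ^ k := hB n
        _ = B * (x ^ (k + 1))⁻¹ * ((n : ℝ) + 1)⁻¹ * ((x * ((n : ℝ) + 1)) ^ (k + 1) * 1) := by
            field_simp
            rw [mul_pow]
            ring
        _ ≤ _ := by
            gcongr
            exact hone δ hδ0 n _
    have hsτ := Summable.of_nonneg_of_le (fun m => by positivity) hωτ (hsq _)
    have hst := Summable.of_nonneg_of_le (fun m => by positivity) hωt (hsq _)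
    have h1 := weighted_lower_bound hc hlow hωpos hpert hsτ ht hst
    have h2 : ∑' n, ‖ω n * t n‖ ^ 2 ≤ (B * (x ^ (k + 1))⁻¹) ^ 2 * ζ := by
      rw [hζ, ← tsum_mul_left]
      exact hst.tsum_le_tsum hωt (hsq _)
    have h3 := hsτ.le_tsum m fun j _ => by positivity
    have h4 : ‖ω m * τ m‖ ^ 2 ≤ (√(4 * ζ / A) * (B * (x ^ (k + 1))⁻¹)) ^ 2 := by
      rw [mul_pow, Real.sq_sqrt (by positivity), div_mul_eq_mul_div, le_div_iff₀ hA]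
      nlinarith
    have h5 := (abs_le_of_sq_le_sq' h4 (by positivity)).2
    rw [norm_mul, Complex.norm_real, Real.norm_of_nonneg (hωpos m).le, hω, polyWeight,
      inv_mul_eq_div, div_le_iff₀ (by positivity)] at h5
    linarith
  have hlim : Tendsto (fun δ : ℝ => √(4 * ζ / A) * (x ^ (k + 1))⁻¹ * B *
      ((1 + x * m) ^ (k + 1) * (1 + δ * m) ^ (q + 1))) (𝓝[>] 0)
      (𝓝 (√(4 * ζ / A) * (x ^ (k + 1))⁻¹ * B *
        ((1 + x * m) ^ (k + 1) * (1 + 0 * m) ^ (q + 1)))) :=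
    (Continuous.tendsto (by fun_prop) 0).mono_left nhdsWithin_le_nhds
  have hev : ∀ᶠ δ : ℝ in 𝓝[>] 0, δ * C₂ ≤ c / 2 := by
    have : Tendsto (fun δ : ℝ => δ * C₂) (𝓝[>] 0) (𝓝 (0 * C₂)) :=
      (Continuous.tendsto (by fun_prop) 0).mono_left nhdsWithin_le_nhds
    rw [zero_mul] at this
    exact this.eventually (Iic_mem_nhds (by positivity))
  have hfin := ge_of_tendsto hlim (b := ‖τ m‖) (by
    filter_upwards [hev, Ioc_mem_nhdsGT (zero_lt_one' ℝ)] with δ h1 h2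
    exact main δ h2.1 h2.2 h1)
  refine hfin.trans ?_
  have hm : x * (m : ℝ) ≤ m := mul_le_of_le_one_left (Nat.cast_nonneg m) hx1
  rw [zero_mul, add_zero, one_pow, mul_one]
  exact mul_le_mul_of_nonneg_left (pow_le_pow_left₀ (by positivity) (by linarith) _)
    (by positivity)

/-! ### Localized frames of Schwartz functions -/

theorem frame_lower_bound {e : ℕ → 𝓢(ℝ, ℂ)}
    (he : IsFrame fun n => (e n).toLp 2 (volume : Measure ℝ)) :
    ∃ A : ℝ, 0 < A ∧ ∀ u : ℕ → ℂ, (Summable fun m => ‖u m‖ ^ 2) →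
      A * ∑' m, ‖u m‖ ^ 2 ≤ ∑' n, ‖∑' m, hermiteCoeff m (e n) * u m‖ ^ 2 := by
  obtain ⟨A, _, hA, _, h⟩ := he
  refine ⟨A, hA, fun u hu => ?_⟩
  -- The frame inequality is applied to the function with Hermite coefficients `conj (u m)`.
  have hmem : Memℓp (fun m => (starRingEnd ℂ) (u m)) 2 := memℓp_gen (by simpa using hu)
  set z := hermiteBasis.repr.symm ⟨_, hmem⟩ with hz
  have hrepr : ∀ m, ⟪hermiteBasis m, z⟫_ℂ = (starRingEnd ℂ) (u m) := fun m => by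
    rw [← hermiteBasis.repr_apply_apply, hz, LinearIsometryEquiv.apply_symm_apply]
  have hnorm : ‖z‖ ^ 2 = ∑' m, ‖u m‖ ^ 2 := by
    rw [hz, LinearIsometryEquiv.norm_map, lp.norm_eq_tsum_rpow (by simp)]
    have h0 : 0 ≤ ∑' m, ‖u m‖ ^ 2 := tsum_nonneg fun m => by positivity
    simp only [ENNReal.toReal_ofNat, Real.rpow_ofNat, RCLike.norm_conj]
    rw [← Real.rpow_natCast, ← Real.rpow_mul h0]
    norm_num
  have hcoef : ∀ n, ‖⟪(e n).toLp 2 (volume : Measure ℝ), z⟫_ℂ‖ =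
      ‖∑' m, hermiteCoeff m (e n) * u m‖ := fun n => by
    rw [← RCLike.norm_conj (∑' m, hermiteCoeff m (e n) * u m), RCLike.conj_tsum,
      ← hermiteBasis.tsum_inner_mul_inner]
    congr 2
    funext m
    rw [hrepr, ← inner_conj_symm, hermiteBasis_apply, inner_hermiteL2_toLp, map_mul]
  have h1 := (h z).2.1
  simp only [hcoef, hnorm] at h1
  exact h1

theorem hermiteCoeff_decay {e : ℕ → 𝓢(ℝ, ℂ)}
    (he : ∀ s : ℕ, 0 < s →
      IsPolynomiallyLocalized (s : ℝ) (fun n => (e n).toLp 2 (volume : Measure ℝ))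
        hermiteL2 hermiteL2) (s : ℕ) :
    ∃ C : ℝ, ∀ n m : ℕ, (1 + |(n : ℝ) - m|) ^ (s + 2) * ‖hermiteCoeff m (e n)‖ ≤ C := by
  obtain ⟨C, hC⟩ := he (s + 2) (by omega)
  refine ⟨C, fun n m => ?_⟩
  have h := hC n m
  rw [max_self, inner_hermiteL2_toLp, Real.rpow_neg (by positivity), Real.rpow_natCast,
    ← div_eq_mul_inv, le_div_iff₀ (by positivity)] at h
  linarith

theorem hermiteBound_of_decay {e : ℕ → 𝓢(ℝ, ℂ)}
    (hloc : ∀ s : ℕ, ∃ C : ℝ, ∀ n m : ℕ,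
      (1 + |(n : ℝ) - m|) ^ (s + 2) * ‖hermiteCoeff m (e n)‖ ≤ C) (q : ℕ) :
    ∃ C : ℝ, 0 ≤ C ∧ ∀ n : ℕ, HermiteBound q (e n) (C * ((n : ℝ) + 1) ^ q) := by
  obtain ⟨C, hC⟩ := hloc q
  have hC0 : 0 ≤ C := le_trans (by positivity) (hC 0 0)
  refine ⟨C, hC0, fun n m => ?_⟩
  set d := |(n : ℝ) - m| with hd
  have hd0 : 0 ≤ d := abs_nonneg _
  have h1 : (m : ℝ) + 1 ≤ (1 + d) * ((n : ℝ) + 1) := by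
    have := one_add_mul_le_mul zero_le_one n m
    linarith
  calc ((m : ℝ) + 1) ^ q * ‖hermiteCoeff m (e n)‖
      ≤ ((1 + d) * ((n : ℝ) + 1)) ^ q * ‖hermiteCoeff m (e n)‖ := by gcongr
    _ = (1 + d) ^ q * ‖hermiteCoeff m (e n)‖ * ((n : ℝ) + 1) ^ q := by rw [mul_pow]; ring
    _ ≤ (1 + d) ^ (q + 2) * ‖hermiteCoeff m (e n)‖ * ((n : ℝ) + 1) ^ q := by
        gcongr
        · linarith
        · omega
    _ ≤ C * ((n : ℝ) + 1) ^ q := by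
        gcongr
        exact hC n m

/-- The values of a continuous functional on a localized frame control the functional: a growth
bound `B (n + 1)^k` on the frame bounds `‖T φ‖` by a multiple of `B` that depends on `φ` and `k`, but
not on `T`. -/
theorem norm_apply_le_of_frame_growth {e : ℕ → 𝓢(ℝ, ℂ)} {A : ℝ} (hA : 0 < A)
    (hlow : ∀ u : ℕ → ℂ, (Summable fun m => ‖u m‖ ^ 2) →
      A * ∑' m, ‖u m‖ ^ 2 ≤ ∑' n, ‖∑' m, hermiteCoeff m (e n) * u m‖ ^ 2)
    (hloc : ∀ s : ℕ, ∃ C : ℝ, ∀ n m : ℕ,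
      (1 + |(n : ℝ) - m|) ^ (s + 2) * ‖hermiteCoeff m (e n)‖ ≤ C) (k : ℕ) :
    ∃ p : 𝓢(ℝ, ℂ) → ℝ, (∀ φ, 0 ≤ p φ) ∧ ∀ (T : 𝓢(ℝ, ℂ) →L[ℂ] ℂ) (B : ℝ),
      (∀ n : ℕ, ‖T (e n)‖ ≤ B * ((n : ℝ) + 1) ^ k) → ∀ φ, ‖T φ‖ ≤ p φ * B := by
  obtain ⟨M, hM, h⟩ := growth_bound_of_localized hA hloc hlow k
  choose b hb using exists_hermiteBound (k + 3)
  have hζ : 0 ≤ ∑' m : ℕ, (((m : ℝ) + 1) ^ 2)⁻¹ := tsum_nonneg fun m => by positivity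
  refine ⟨fun φ => b φ * M * ∑' m : ℕ, (((m : ℝ) + 1) ^ 2)⁻¹,
    fun φ => mul_nonneg (mul_nonneg (hb φ).nonneg hM) hζ, fun T B hB φ => ?_⟩
  obtain ⟨q, D, -, hD⟩ := exists_norm_apply_hermiteSchwartz_le T
  have hB0 : 0 ≤ B := by simpa using (norm_nonneg _).trans (hB 0)
  have hT := h _ _ q D B hD (fun n => hasSum_hermiteCoeff_mul T (e n)) hB
  have hs := (hasSum_hermiteCoeff_mul T φ).tsum_eq
  rw [← hs]
  refine (tsum_of_norm_bounded (summable_inv_add_one_sq.mul_left (b φ * M * B)).hasSum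
    fun m => ?_).trans (le_of_eq (by rw [tsum_mul_left]; ring))
  rw [norm_mul, ← div_eq_mul_inv, le_div_iff₀ (by positivity)]
  calc ‖hermiteCoeff m φ‖ * ‖T (hermiteSchwartz m)‖ * ((m : ℝ) + 1) ^ 2
      ≤ ‖hermiteCoeff m φ‖ * (M * B * ((m : ℝ) + 1) ^ (k + 1)) * ((m : ℝ) + 1) ^ 2 := by
        gcongr
        exact hT m
    _ = (((m : ℝ) + 1) ^ (k + 3) * ‖hermiteCoeff m φ‖) * (M * B) := by ring
    _ ≤ b φ * (M * B) := by
        gcongr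
        exact hb φ m
    _ = b φ * M * B := by ring

/-- Functionals that converge on a localized frame and obey a uniform growth bound there converge
on every Schwartz function. -/
theorem exists_tendsto_of_frame {ι : Type*} {l : Filter ι} [l.NeBot] [l.IsCountablyGenerated]
    {e : ℕ → 𝓢(ℝ, ℂ)} {A : ℝ} (hA : 0 < A)
    (hlow : ∀ u : ℕ → ℂ, (Summable fun m => ‖u m‖ ^ 2) →
      A * ∑' m, ‖u m‖ ^ 2 ≤ ∑' n, ‖∑' m, hermiteCoeff m (e n) * u m‖ ^ 2)
    (hloc : ∀ s : ℕ, ∃ C : ℝ, ∀ n m : ℕ,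
      (1 + |(n : ℝ) - m|) ^ (s + 2) * ‖hermiteCoeff m (e n)‖ ≤ C)
    (T : ι → 𝓢(ℝ, ℂ) →L[ℂ] ℂ) {k : ℕ} {C : ℝ}
    (hbound : ∀ᶠ i in l, ∀ n : ℕ, ‖T i (e n)‖ ≤ C * ((n : ℝ) + 1) ^ k)
    (hlim : ∀ n, ∃ c, Tendsto (fun i => T i (e n)) l (𝓝 c)) :
    ∃ g : 𝓢(ℝ, ℂ) →L[ℂ] ℂ, ∀ φ, Tendsto (fun i => T i φ) l (𝓝 (g φ)) := by
  choose c hc using hlim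
  -- One extra power of `n + 1` makes the differences `T i - T j` uniformly small on the frame:
  -- the growth bound handles large `n`, convergence handles the remaining finitely many.
  obtain ⟨p, hp, hT⟩ := norm_apply_le_of_frame_growth hA hlow hloc (k + 1)
  have hC : 0 ≤ C := by
    obtain ⟨i, hi⟩ := hbound.exists
    simpa using (norm_nonneg _).trans (hi 0)
  have hcauchy : ∀ φ, ∃ y, Tendsto (fun i => T i φ) l (𝓝 y) := by
    intro φ
    refine cauchy_map_iff_exists_tendsto.1 ?_
    rw [Metric.cauchy_iff]
    refine ⟨inferInstance, fun η hη => ?_⟩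
    set B : ℝ := η / (p φ + 1) with hBdef
    have hp' : 0 < p φ + 1 := by linarith [hp φ]
    have hB : 0 < B := by positivity
    obtain ⟨N, hN⟩ := exists_nat_gt (2 * C / B)
    have hfin : ∀ᶠ i in l, ∀ n ∈ Finset.range N, ‖T i (e n) - c n‖ < B / 2 :=
      (Filter.eventually_all_finset _).2 fun n _ => by
        have := (hc n).eventually (Metric.ball_mem_nhds _ (half_pos hB))
        simpa [Metric.mem_ball, dist_eq_norm] using this
    refine ⟨_, image_mem_map (hbound.and hfin), ?_⟩
    rintro _ ⟨i, ⟨hi1, hi2⟩, rfl⟩ _ ⟨j, ⟨hj1, hj2⟩, rfl⟩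
    have hdiff : ∀ n : ℕ, ‖(T i - T j) (e n)‖ ≤ B * ((n : ℝ) + 1) ^ (k + 1) := by
      intro n
      rw [sub_apply]
      rcases lt_or_ge n N with hn | hn
      · have h1 := hi2 n (Finset.mem_range.2 hn)
        have h2 := hj2 n (Finset.mem_range.2 hn)
        have h3 : ‖T i (e n) - T j (e n)‖ ≤ ‖T i (e n) - c n‖ + ‖T j (e n) - c n‖ := by
          rw [← sub_sub_sub_cancel_right _ _ (c n)]
          exact norm_sub_le _ _
        have h4 : (1 : ℝ) ≤ ((n : ℝ) + 1) ^ (k + 1) := one_le_pow₀ (by simp)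
        nlinarith
      · have h1 : 2 * C ≤ B * ((n : ℝ) + 1) := by
          rw [div_lt_iff₀ hB] at hN
          have : (N : ℝ) ≤ n := by exact_mod_cast hn
          nlinarith
        have h2 : (0 : ℝ) ≤ ((n : ℝ) + 1) ^ k := by positivity
        calc ‖T i (e n) - T j (e n)‖ ≤ ‖T i (e n)‖ + ‖T j (e n)‖ := norm_sub_le _ _
          _ ≤ 2 * C * ((n : ℝ) + 1) ^ k := by linarith [hi1 n, hj1 n]
          _ ≤ B * ((n : ℝ) + 1) * ((n : ℝ) + 1) ^ k := by gcongr
          _ = B * ((n : ℝ) + 1) ^ (k + 1) := by ring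
    have h1 := hT (T i - T j) B hdiff φ
    rw [dist_eq_norm, ← sub_apply]
    refine h1.trans_lt ?_
    rw [hBdef, ← mul_div_assoc, div_lt_iff₀ hp']
    nlinarith
  choose y hy using hcauchy
  exact ⟨continuousLinearMapOfTendsto T (tendsto_pi_nhds.2 hy), hy⟩

/-- Functionals that converge pointwise along `𝓝[>] 0` obey a uniform polynomial growth bound on a
localized sequence. -/
theorem exists_frame_growth_of_tendsto {e : ℕ → 𝓢(ℝ, ℂ)}
    (hloc : ∀ s : ℕ, ∃ C : ℝ, ∀ n m : ℕ,
      (1 + |(n : ℝ) - m|) ^ (s + 2) * ‖hermiteCoeff m (e n)‖ ≤ C)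
    (T : ℝ → 𝓢(ℝ, ℂ) →L[ℂ] ℂ) (g : 𝓢(ℝ, ℂ) → ℂ)
    (hlim : ∀ φ, Tendsto (fun ε => T ε φ) (𝓝[>] 0) (𝓝 (g φ))) :
    ∃ (k : ℕ) (ε₀ : ℝ), 0 < ε₀ ∧ ∃ C : ℝ, ∀ ε ∈ Ioo 0 ε₀, ∀ n : ℕ,
      ‖T ε (e n)‖ ≤ C * ((n : ℝ) + 1) ^ k := by
  by_contra! hcon
  -- Failure for every `k` gives a sequence `εⱼ → 0` along which the growth order is unbounded.
  choose ε hε n hn using fun j : ℕ => hcon j (1 / ((j : ℝ) + 1)) Nat.one_div_pos_of_nat j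
  have hε0 : Tendsto ε atTop (𝓝[>] 0) := by
    refine tendsto_nhdsWithin_iff.2 ⟨?_, Eventually.of_forall fun j => (hε j).1⟩
    exact squeeze_zero (fun j => (hε j).1.le) (fun j => (hε j).2.le)
      tendsto_one_div_add_atTop_nhds_zero_nat
  obtain ⟨s, D, hD⟩ := SchwartzMap.exists_bound_of_pointwise_bounded (fun j => T (ε j)) fun φ => by
    obtain ⟨M, hM⟩ := ((hlim φ).comp hε0).norm.bddAbove_range
    exact ⟨M, fun j => hM ⟨j, rfl⟩⟩
  obtain ⟨q, D', hD', hq⟩ := finset_sup_seminorm_le_of_hermiteBound s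
  obtain ⟨C, hC, he⟩ := hermiteBound_of_decay hloc q
  obtain ⟨j, hj⟩ := exists_nat_ge (max (q : ℝ) (|D| * (D' * C)))
  have hqj : q ≤ j := by exact_mod_cast (le_max_left _ _).trans hj
  refine absurd (hn j) (not_lt.2 ?_)
  calc ‖T (ε j) (e (n j))‖ ≤ D * (s.sup (schwartzSeminormFamily ℂ ℝ ℂ)) (e (n j)) := hD j _
    _ ≤ |D| * (D' * (C * ((n j : ℝ) + 1) ^ q)) :=
        mul_le_mul (le_abs_self D) (hq _ _ (he (n j))) (apply_nonneg _ _) (abs_nonneg D)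
    _ = |D| * (D' * C) * ((n j : ℝ) + 1) ^ q := by ring
    _ ≤ j * ((n j : ℝ) + 1) ^ j := by
        gcongr
        · exact (le_max_right _ _).trans hj
        · simp

theorem norm_normalizedRescale {α x₀ : ℝ} {L : ℝ → ℝ} {f : 𝓢'(ℝ, ℂ)} {ε : ℝ} (hε : 0 < ε)
    (hL : 0 < L ε) (φ : 𝓢(ℝ, ℂ)) :
    ‖normalizedRescale α x₀ L f ε φ‖ = ‖rescaleDistribution x₀ ε f φ‖ / (ε ^ α * L ε) := by
  have h1 : normalizedRescale α x₀ L f ε φ =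
      (((ε ^ α * L ε)⁻¹ : ℝ) : ℂ) * rescaleDistribution x₀ ε f φ := rfl
  rw [h1, norm_mul, Complex.norm_real, Real.norm_of_nonneg (by positivity), inv_mul_eq_div]

theorem theorem6p1
    (e : ℕ → 𝓢(ℝ, ℂ))
    (he_frame : IsFrame fun n => (e n).toLp 2 (volume : Measure ℝ))
    (he_loc : ∀ s : ℕ, 0 < s →
      IsPolynomiallyLocalized (s : ℝ) (fun n => (e n).toLp 2 (volume : Measure ℝ))
        hermiteL2 hermiteL2)
    (L : ℝ → ℝ) (hL : IsSlowlyVaryingAtOrigin L) (α x₀ : ℝ) (f : 𝓢'(ℝ, ℂ)) :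
    HasQuasiasymptoticBehavior α x₀ L f ↔
      (∀ n : ℕ, ∃ c : ℂ,
        Tendsto (fun ε => normalizedRescale α x₀ L f ε (e n)) (𝓝[>] 0) (𝓝 c)) ∧
      (∃ k : ℕ, ∃ ε₀ : ℝ, 0 < ε₀ ∧ ∃ C : ℝ, ∀ ε ∈ Ioo 0 ε₀, ∀ n : ℕ,
        ‖rescaleDistribution x₀ ε f (e n)‖ / (ε ^ α * L ε * ((n : ℝ) + 1) ^ k) ≤ C) := by
  obtain ⟨⟨a, ha, -, hLpos⟩, -⟩ := hL
  have hloc := hermiteCoeff_decay he_loc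
  have hquot : ∀ ε ∈ Ioo 0 a, ∀ (n k : ℕ),
      ‖rescaleDistribution x₀ ε f (e n)‖ / (ε ^ α * L ε * ((n : ℝ) + 1) ^ k) =
        ‖normalizedRescale α x₀ L f ε (e n)‖ / ((n : ℝ) + 1) ^ k := fun ε hε n k => by
    rw [norm_normalizedRescale hε.1 (hLpos ε ⟨hε.1, hε.2.le⟩), div_div]
  constructor
  · rintro ⟨g, hg⟩
    refine ⟨fun n => ⟨_, hg (e n)⟩, ?_⟩
    obtain ⟨k, ε₀, hε₀, C, hC⟩ :=
      exists_frame_growth_of_tendsto hloc (fun ε => normalizedRescale α x₀ L f ε) g hg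
    refine ⟨k, min ε₀ a, lt_min hε₀ ha, C, fun ε hε n => ?_⟩
    rw [hquot ε ⟨hε.1, hε.2.trans_le (min_le_right _ _)⟩, div_le_iff₀ (by positivity)]
    exact hC ε ⟨hε.1, hε.2.trans_le (min_le_left _ _)⟩ n
  · rintro ⟨hlim, k, ε₀, hε₀, C, hC⟩
    obtain ⟨A, hA, hlow⟩ := frame_lower_bound he_frame
    refine exists_tendsto_of_frame hA hlow hloc (fun ε => normalizedRescale α x₀ L f ε)
      (k := k) (C := C) ?_ hlim
    filter_upwards [Ioo_mem_nhdsGT (lt_min hε₀ ha)] with ε hε n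
    have h1 := hC ε ⟨hε.1, hε.2.trans_le (min_le_left _ _)⟩ n
    rwa [hquot ε ⟨hε.1, hε.2.trans_le (min_le_right _ _)⟩, div_le_iff₀ (by positivity)] at h1
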